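/- **Setting.** Let $\mathcal M$ be a layered Low-Rank MDP with horizon $H$, measurable state space $\mathcal X=\mathcal X_1\sqcup\dots\sqcup\mathcal X_H$, finite action space $\mathcal A$ with $|\mathcal A|=A\ge 1$, and initial distribution $\rho$ on $\mathcal X_1$. For $h<H$ the transition kernel $T_h(\cdot\mid x,a)$, $x\in\mathcal X_h$, is a probability measure carried by $\mathcal X_{h+1}$ with the (everywhere non-negative) density $y\mapsto \mu^\star_{h+1}(y)^\top\phi^\star_h(x,a)$ with respect to a $\sigma$-finite measure $\nu$ on $\mathcal X$, where $\mu^\star_h:\mathcal X\to\mathbb R^d$, $\phi^\star_h:\mathcal X\times\mathcal A\to\mathbb R^d$. Assume that $\|\phi_h^\star(x,a)\|\le 1$ for $x\in\mathcal X_h$, and that $\mu^\star_h$ is $\nu$-integrable on $\mathcal X_h$ with $\big\|\int_{\mathcal X_h}\mu_h^\star\, g\,d\nu\big\|\le\sqrt d$ for all measurable $g:\mathcal X_h\to[0,1]$, for every $h\in[H]$. Let $\Pi_{\mathtt M}$ be the set of randomized Markov policies $\pi:\mathcal X\to\Delta(\mathcal A)$, $\mathbb E^\pi$ the expectation over the trajectory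 $(x_1,a_1),\dots,(x_H,a_H)$ when $\pi$ is played, and $d^\pi(x)$, $x\in\mathcal X_h$, the density with respect to $\nu$ of the law of $x_h$ under $\pi$ (for $h\ge2$ the version $d^\pi(x)=\mu_h^\star(x)^\top\mathbb E^\pi[\phi^\star_{h-1}(x_{h-1},a_{h-1})]$). A distribution $P\in\Delta(\Pi_{\mathtt M})$ is an $(\alpha,\varepsilon)$-randomized policy cover for layer $h$ if $\mathbb E_{\pi\sim P}[d^\pi(x)]\ge\alpha\sup_{\pi'\in\Pi_{\mathtt M}}d^{\pi'}(x)$ for all $x\in\mathcal X_h$ with $\sup_{\pi'\in\Pi_{\mathtt M}}d^{\pi'}(x)\ge\varepsilon\|\mu_h^\star(x)\|$. Let $\Phi$ be a finite class of measurable maps $\phi:\mathcal X\times\mathcal A\to\mathbb R^d$ with $\|\phi(x,a)\|\le1$ for all $(x,a)$ and $\phi^\star_h\in\Phi$ for all $h\in[H]$. **Algorithm.** Given rewards $r_{1:H}$, function classes $\mathcal G_{1:H}$, distributions $P^{(1)},\dots,P^{(H)}\in\Delta(\Pi_{\mathtt M})$ and $n\ge1$, $\mathtt{PSDP}(H,r_{1:H},\mathcal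 G_{1:H},P^{(1:H)},n)$ does the following for $t=H,\dots,1$. It draws $n$ independent samples $(x_t,a_t,\sum_{\ell=t}^Hr_\ell(x_\ell,a_\ell))$, each from an episode in which a fresh $\pi\sim P^{(t)}$ is played on layers $1,\dots,t-1$, a uniformly random action on layer $t$, and the already learned policy $\hat\pi^{(t+1)}$ on layers $t+1,\dots,H$. It takes a least-squares solution $\hat g^{(t)}\in\arg\min_{g\in\mathcal G_t}\sum_{(x,a,R)}(g(x,a)-R)^2$ over these samples, and lets $\hat\pi^{(t)}(x)\in\arg\max_{a}\hat g^{(t)}(x,a)$ for $x\in\mathcal X_t$ and $\hat\pi^{(t)}=\hat\pi^{(t+1)}$ on the later layers. It returns $\hat\pi=\hat\pi^{(1)}$. (Ties in the $\arg\min$ and the $\arg\max$ are broken by any measurable rule.) **Statement.** There is an absolute constant $c>0$ such that the following holds for all $\mathcal M$ and $\Phi$ as above, all $\alpha,\varepsilon,\delta\in(0,1)$ and all $n\ge1$. Let $r_h(x,a)=\theta_h^\top\phi_h^\star(x,a)$ with $\theta_h\in\mathbb R^d$, $\|\theta_h\|\le1$, for $h\in[H]$; let $$\mathcal G_h=\mathcal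 G=\{(x,a)\mapsto\phi(x,a)^\top w\;:\;\phi\in\Phi,\ w\in\mathbb R^d,\ \|w\|\le 2H\sqrt d\}\qquad(h\in[H]);$$ and let $P^{(h)}$ be an $(\alpha,\varepsilon)$-randomized policy cover for layer $h$, for each $h\in[H]$. Then, with probability at least $1-\delta$, the output $\hat\pi$ of $\mathtt{PSDP}(H,r_{1:H},\mathcal G_{1:H},P^{(1:H)},n)$ satisfies $$\sup_{\pi\in\Pi_{\mathtt M}}\mathbb E^{\pi}\Big[\sum_{h=1}^Hr_h(x_h,a_h)\Big]\le\mathbb E^{\hat\pi}\Big[\sum_{h=1}^Hr_h(x_h,a_h)\Big]+cH^2\sqrt{\frac{dA\,\big(d\log(2n\sqrt d\,H)+\ln(n|\Phi|/\delta)\big)}{\alpha n}}+2H^2\varepsilon d^{3/2}.$$ -/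

import Mathlib

open MeasureTheory ProbabilityTheory

namespace LowRank

noncomputable section

/-- A randomized Markovian policy `π : 𝒳 → Δ(𝒜)`, as a Markov kernel. -/
def Policy (X A : Type*) [MeasurableSpace X] [MeasurableSpace A] :=
  {κ : Kernel X A // IsMarkovKernel κ}

/-- A layered Low-Rank MDP with horizon `H` and feature dimension `d`.
Layers (time steps) are numbered `0, …, H - 1`, and `layer x = h` says that `x ∈ 𝒳_h`; so the
sets `𝒳_h` are disjoint, measurable and cover the state space.  Since the layers are disjoint, a
single kernel `T` holds all the transition kernels: `T (x, a)` is `T_h(· ∣ x, a)` when `x ∈ 𝒳_h`.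
The value of `T` on the last layer never matters. -/
structure LowRankMDP (X A : Type*) [MeasurableSpace X] [MeasurableSpace A] (d H : ℕ) where
  /-- law of the initial state -/
  ρ : Measure X
  ρ_prob : IsProbabilityMeasure ρ
  /-- transition kernel -/
  T : Kernel (X × A) X
  T_markov : IsMarkovKernel T
  /-- base measure -/
  ν : Measure X
  ν_sigmaFinite : SigmaFinite ν
  layer : X → Fin H
  layer_measurable : Measurable layer
  /-- the true features `φ⋆_h` -/
  φ : Fin H → X → A → EuclideanSpace ℝ (Fin d)
  φ_measurable : ∀ h a, Measurable fun x => φ h x a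
  /-- the maps `μ⋆_h` -/
  μ : Fin H → X → EuclideanSpace ℝ (Fin d)
  μ_measurable : ∀ h, Measurable (μ h)
  ρ_layer : ∀ᵐ x ∂ρ, (layer x : ℕ) = 0
  T_layer : ∀ x a, (layer x : ℕ) + 1 < H → ∀ᵐ y ∂(T (x, a)), (layer y : ℕ) = layer x + 1
  /-- `y ↦ ⟨μ⋆_{h+1}(y), φ⋆_h(x, a)⟩` is nonnegative ... -/
  density_nonneg : ∀ h h' : Fin H, (h' : ℕ) = h + 1 → ∀ x, layer x = h → ∀ a y,
    0 ≤ inner ℝ (μ h' y) (φ h x a)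
  /-- ... and it is the density of `T_h(· ∣ x, a)` with respect to `ν`. -/
  T_eq : ∀ h h' : Fin H, (h' : ℕ) = h + 1 → ∀ x, layer x = h → ∀ a,
    T (x, a) = ν.withDensity fun y => ENNReal.ofReal (inner ℝ (μ h' y) (φ h x a))
  φ_norm : ∀ h x a, layer x = h → ‖φ h x a‖ ≤ 1
  μ_integrable : ∀ h, IntegrableOn (μ h) {x | layer x = h} ν
  μ_normalized : ∀ h, ∀ g : X → ℝ, Measurable g → (∀ x, 0 ≤ g x ∧ g x ≤ 1) →
    ‖∫ x in {x | layer x = h}, g x • μ h x ∂ν‖ ≤ √(d : ℝ)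

attribute [instance] LowRankMDP.ρ_prob LowRankMDP.T_markov LowRankMDP.ν_sigmaFinite

variable {X A : Type*} [MeasurableSpace X] [MeasurableSpace A] {d H : ℕ}

namespace LowRankMDP

/-! ### Trajectories -/

/-- Law of the `k` state-action pairs met from now on, when the current state is `x` and the
policy `π` is played: `a ∼ π(x)`, `x' ∼ T(x, a)`, and so on from `x'`. -/
def rollout (M : LowRankMDP X A d H) (π : Policy X A) : (k : ℕ) → Kernel X (Fin k → X × A)
  | 0 => Kernel.const X (Measure.dirac Fin.elim0)
  | k + 1 => ((Kernel.id ×ₖ (rollout M π k ∘ₖ M.T)) ∘ₖ (Kernel.id ×ₖ π.1)).map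
      fun p => Fin.cons (α := fun _ => X × A) p.1 p.2

/-- `ℙ^π`: the law of `(x_0, a_0), …, (x_{H-1}, a_{H-1})`. -/
def trajLaw (M : LowRankMDP X A d H) (π : Policy X A) : Measure (Fin H → X × A) :=
  M.ρ.bind (M.rollout π H)

/-- `ℙ_h^π`: the law of `x_h`. -/
def stateLaw (M : LowRankMDP X A d H) (π : Policy X A) (h : Fin H) : Measure X :=
  (M.trajLaw π).map fun τ => (τ h).1

/-- `𝔼^π[∑_h r_h(x_h, a_h)]`. -/
def value (M : LowRankMDP X A d H) (r : Fin H → X → A → ℝ) (π : Policy X A) : ℝ :=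
  ∫ τ, ∑ h, r h (τ h).1 (τ h).2 ∂(M.trajLaw π)

/-- The occupancy `d^π(x)` for `x` in layer `h`: the density of `ℙ_h^π` with respect to `ν`.
On the layers after the first one it is the everywhere defined version
`⟨μ⋆_h(x), 𝔼^π[φ⋆_{h-1}(x_{h-1}, a_{h-1})]⟩` of the density; on the first layer `ℙ_0^π = ρ`
whatever `π` is. -/
def occupancy (M : LowRankMDP X A d H) (π : Policy X A) (h : Fin H) (x : X) : ℝ :=
  if (h : ℕ) = 0 then (M.ρ.rnDeriv M.ν x).toReal
  else
    let g : Fin H := ⟨(h : ℕ) - 1, lt_of_le_of_lt (Nat.sub_le _ _) h.2⟩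
    inner ℝ (M.μ h x) (∫ τ, M.φ g (τ g).1 (τ g).2 ∂(M.trajLaw π))

/-! The everywhere defined occupancy is indeed a density of the law of the state. -/

lemma measurable_cons {k : ℕ} : Measurable fun p : (X × A) × (Fin k → X × A) =>
    Fin.cons (α := fun _ => X × A) p.1 p.2 := by
  refine measurable_pi_iff.2 fun i => ?_
  refine Fin.cases ?_ (fun j => ?_) i
  · simpa using measurable_fst
  · simp only [Fin.cons_succ]
    exact (measurable_pi_apply j).comp measurable_snd

instance rollout_markov (M : LowRankMDP X A d H) (π : Policy X A) (k : ℕ) :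
    IsMarkovKernel (M.rollout π k) := by
  have := π.2
  induction k with
  | zero => rw [rollout]; infer_instance
  | succ k ih => rw [rollout]; exact Kernel.IsMarkovKernel.map _ measurable_cons

instance trajLaw_prob (M : LowRankMDP X A d H) (π : Policy X A) :
    IsProbabilityMeasure (M.trajLaw π) := by
  unfold trajLaw; infer_instance

lemma lintegral_rollout_succ (M : LowRankMDP X A d H) (π : Policy X A) (k : ℕ) (x : X)
    {f : (Fin (k + 1) → X × A) → ENNReal} (hf : Measurable f) :
    ∫⁻ τ, f τ ∂(M.rollout π (k + 1) x) =
      ∫⁻ a, ∫⁻ y, ∫⁻ τ, f (Fin.cons (x, a) τ) ∂(M.rollout π k y) ∂(M.T (x, a)) ∂(π.1 x) := by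
  have := π.2
  have hc : Measurable fun p : (X × A) × (Fin k → X × A) =>
      f (Fin.cons (α := fun _ => X × A) p.1 p.2) := hf.comp measurable_cons
  rw [rollout, Kernel.map_apply _ measurable_cons, lintegral_map hf measurable_cons,
    Kernel.lintegral_comp _ _ _ hc, Kernel.lintegral_id_prod]
  · refine lintegral_congr fun a => ?_
    rw [Kernel.lintegral_id_prod hc, Kernel.lintegral_comp]
    exact hc.comp measurable_prodMk_left
  · exact hc.lintegral_kernel

lemma lintegral_rollout_zero (M : LowRankMDP X A d H) (π : Policy X A) (k : ℕ) (x : X)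
    {f : X → ENNReal} (hf : Measurable f) :
    ∫⁻ τ, f (τ 0).1 ∂(M.rollout π (k + 1) x) = f x := by
  have := π.2
  rw [lintegral_rollout_succ]
  · simp
  · exact hf.comp (measurable_fst.comp (measurable_pi_apply 0))

lemma lintegral_rollout_step (M : LowRankMDP X A d H) (π : Policy X A) {f : X → ENNReal}
    (hf : Measurable f) (k : ℕ) : ∀ (x : X) (h h' : Fin k), (h' : ℕ) = h + 1 →
    ∫⁻ τ, f (τ h').1 ∂(M.rollout π k x) =
      ∫⁻ τ, ∫⁻ y, f y ∂(M.T (τ h)) ∂(M.rollout π k x) := by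
  have := π.2
  induction k with
  | zero => intro x h; exact h.elim0
  | succ k ih =>
    intro x h h' hh
    have m1 : ∀ {k} (j : Fin k), Measurable fun τ : Fin k → X × A => f (τ j).1 := fun j =>
      hf.comp (measurable_fst.comp (measurable_pi_apply j))
    have m2 : ∀ {k} (j : Fin k), Measurable fun τ : Fin k → X × A => ∫⁻ y, f y ∂(M.T (τ j)) :=
      fun j => (hf.lintegral_kernel (κ := M.T)).comp (measurable_pi_apply j)
    rw [lintegral_rollout_succ _ _ _ _ (m1 h'), lintegral_rollout_succ _ _ _ _ (m2 h)]
    refine lintegral_congr fun a => ?_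
    obtain ⟨j', rfl⟩ : ∃ j', h' = Fin.succ j' :=
      ⟨h'.pred (by rintro rfl; simp at hh), by simp⟩
    simp only [Fin.cons_succ]
    rcases Fin.eq_zero_or_eq_succ h with rfl | ⟨j, rfl⟩
    · obtain ⟨k, rfl⟩ : ∃ k', k = k' + 1 := ⟨k - 1, by have := j'.2; omega⟩
      have : j' = 0 := by ext; simpa using hh
      subst this
      simp [lintegral_rollout_zero _ _ _ _ hf]
    · refine lintegral_congr fun y => ?_
      simp only [Fin.cons_succ]
      exact ih y j j' (by simpa using hh)

lemma lintegral_trajLaw_step (M : LowRankMDP X A d H) (π : Policy X A) {f : X → ENNReal}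
    (hf : Measurable f) (h h' : Fin H) (hh : (h' : ℕ) = h + 1) :
    ∫⁻ τ, f (τ h').1 ∂(M.trajLaw π) = ∫⁻ τ, ∫⁻ y, f y ∂(M.T (τ h)) ∂(M.trajLaw π) := by
  unfold trajLaw
  rw [Measure.lintegral_bind (Kernel.aemeasurable _), Measure.lintegral_bind (Kernel.aemeasurable _)]
  · exact lintegral_congr fun x => lintegral_rollout_step M π hf H x h h' hh
  · exact ((hf.lintegral_kernel (κ := M.T)).comp (measurable_pi_apply h)).aemeasurable
  · exact (hf.comp (measurable_fst.comp (measurable_pi_apply h'))).aemeasurable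

lemma stateLaw_zero (M : LowRankMDP X A d H) (π : Policy X A) (h : Fin H) (hh : (h : ℕ) = 0) :
    M.stateLaw π h = M.ρ := by
  obtain ⟨H, rfl⟩ : ∃ k', H = k' + 1 := ⟨H - 1, by have := h.2; omega⟩
  have : h = 0 := by ext; simpa using hh
  subst this
  ext s hs
  have m : Measurable fun τ : Fin (H + 1) → X × A => (τ 0).1 :=
    measurable_fst.comp (measurable_pi_apply 0)
  rw [stateLaw, ← lintegral_indicator_one hs, lintegral_map (measurable_one.indicator hs) m,
    trajLaw, Measure.lintegral_bind (Kernel.aemeasurable _)]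
  · simp_rw [lintegral_rollout_zero M π H _ (f := s.indicator 1) (measurable_one.indicator hs)]
    rw [lintegral_indicator_one hs]
  · exact ((measurable_one.indicator hs).comp m).aemeasurable

lemma ae_layer (M : LowRankMDP X A d H) (π : Policy X A) : ∀ (k : ℕ) (hk : k < H),
    ∀ᵐ τ ∂(M.trajLaw π), M.layer (τ ⟨k, hk⟩).1 = ⟨k, hk⟩ := by
  intro k
  have m : ∀ h : Fin H, Measurable fun τ : Fin H → X × A => (τ h).1 := fun h =>
    measurable_fst.comp (measurable_pi_apply h)
  induction k with
  | zero =>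
    intro hk
    have := M.ρ_layer
    rw [← stateLaw_zero M π ⟨0, hk⟩ rfl, stateLaw] at this
    filter_upwards [ae_of_ae_map (m _).aemeasurable this] with τ hτ
    ext; simpa using hτ
  | succ k ih =>
    intro hk
    have hs : MeasurableSet {x | M.layer x ≠ ⟨k + 1, hk⟩} :=
      M.layer_measurable (MeasurableSet.of_discrete (s := {j : Fin H | j ≠ ⟨k + 1, hk⟩}))
    have key := lintegral_trajLaw_step M π (f := {x | M.layer x ≠ ⟨k + 1, hk⟩}.indicator 1)
      (measurable_one.indicator hs) ⟨k, by omega⟩ ⟨k + 1, hk⟩ rfl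
    have z : ∫⁻ τ, ∫⁻ y, {x | M.layer x ≠ ⟨k + 1, hk⟩}.indicator 1 y ∂(M.T (τ ⟨k, by omega⟩))
        ∂(M.trajLaw π) = 0 := by
      rw [← lintegral_zero (μ := M.trajLaw π)]
      refine lintegral_congr_ae ?_
      filter_upwards [ih (by omega)] with τ hτ
      rw [lintegral_indicator_one hs]
      have := M.T_layer (τ ⟨k, by omega⟩).1 (τ ⟨k, by omega⟩).2 (by rw [hτ]; exact hk)
      rw [hτ] at this
      refine measure_mono_null ?_ (ae_iff.1 this)
      intro y hy h
      exact hy (by ext; simpa using h)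
    rw [z] at key
    filter_upwards [(lintegral_eq_zero_iff ((measurable_one.indicator hs).comp (m _))).1 key] with τ hτ
    by_contra hne
    simp [hne] at hτ

/-- The occupancy is the density of the law of the state, on every layer after the first one. -/
theorem stateLaw_eq_withDensity [Fintype A] [MeasurableSingletonClass A]
    (M : LowRankMDP X A d H) (π : Policy X A) (h : Fin H) (hh : (h : ℕ) ≠ 0) :
    M.stateLaw π h = M.ν.withDensity fun x => ENNReal.ofReal (M.occupancy π h x) := by
  set g : Fin H := ⟨(h : ℕ) - 1, lt_of_le_of_lt (Nat.sub_le _ _) h.2⟩ with hg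
  have hgh : (h : ℕ) = g + 1 := by simp [hg]; omega
  have mφ : Measurable fun τ : Fin H → X × A => M.φ g (τ g).1 (τ g).2 :=
    (measurable_from_prod_countable_left (f := fun p : X × A => M.φ g p.1 p.2)
      (M.φ_measurable g)).comp (measurable_pi_apply g)
  have aeg := ae_layer M π g g.2
  have iφ : Integrable (fun τ : Fin H → X × A => M.φ g (τ g).1 (τ g).2) (M.trajLaw π) := by
    refine Integrable.of_bound mφ.aestronglyMeasurable 1 ?_
    filter_upwards [aeg] with τ hτ
    exact M.φ_norm g _ _ hτ
  have m : Measurable fun τ : Fin H → X × A => (τ h).1 :=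
    measurable_fst.comp (measurable_pi_apply h)
  ext s hs
  rw [stateLaw, ← lintegral_indicator_one hs, lintegral_map (measurable_one.indicator hs) m,
    lintegral_trajLaw_step M π (measurable_one.indicator hs) g h hgh,
    withDensity_apply _ hs]
  have e1 : ∫⁻ τ, ∫⁻ y, s.indicator 1 y ∂(M.T (τ g)) ∂(M.trajLaw π) =
      ∫⁻ τ, ∫⁻ y in s, ENNReal.ofReal (inner ℝ (M.μ h y) (M.φ g (τ g).1 (τ g).2)) ∂M.ν
        ∂(M.trajLaw π) := by
    refine lintegral_congr_ae ?_
    filter_upwards [aeg] with τ hτ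
    rw [lintegral_indicator_one hs, ← withDensity_apply _ hs, ← M.T_eq g h hgh _ hτ]
  rw [e1, lintegral_lintegral_swap]
  · refine lintegral_congr fun y => ?_
    rw [occupancy, if_neg hh, ← ofReal_integral_eq_lintegral_ofReal]
    · congr 1
      exact integral_inner iφ _
    · exact iφ.const_inner _
    · filter_upwards [aeg] with τ hτ
      exact M.density_nonneg g h hgh _ hτ _ _
  · refine Measurable.aemeasurable (ENNReal.measurable_ofReal.comp ?_)
    exact ((M.μ_measurable h).comp measurable_snd).inner (mφ.comp measurable_fst)

end LowRankMDP

/-! ### Distributions over policies and policy covers -/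

/-- A distribution `P ∈ Δ(Π_M)`: a policy chosen through a random index. The policy with index `i`
is `x ↦ kernel (i, x)`. -/
structure PolicyDist.{u, v, w} (X : Type u) (A : Type v) [MeasurableSpace X]
    [MeasurableSpace A] where
  Idx : Type w
  idxSpace : MeasurableSpace Idx
  law : Measure Idx
  law_prob : IsProbabilityMeasure law
  kernel : Kernel (Idx × X) A
  kernel_markov : IsMarkovKernel kernel

attribute [instance] PolicyDist.idxSpace PolicyDist.law_prob PolicyDist.kernel_markov

/-- The policy with index `i`. -/
def PolicyDist.policy (P : PolicyDist X A) (i : P.Idx) : Policy X A :=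
  ⟨P.kernel.comap (fun x => (i, x)) measurable_prodMk_left, inferInstance⟩

/-- `P` is an `(α, ε)`-randomized policy cover for layer `h`. -/
def IsRandomizedPolicyCover (M : LowRankMDP X A d H) (P : PolicyDist X A) (α ε : ℝ)
    (h : Fin H) : Prop :=
  ∀ x, M.layer x = h → ε * ‖M.μ h x‖ ≤ (⨆ π : Policy X A, M.occupancy π h x) →
    α * (⨆ π : Policy X A, M.occupancy π h x) ≤ ∫ i, M.occupancy (P.policy i) h x ∂P.law

/-! ### Rewards and function classes -/

/-- The rewards `r_h(x, a) = ⟨θ_h, φ⋆_h(x, a)⟩`. -/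
def linearReward (M : LowRankMDP X A d H) (θ : Fin H → EuclideanSpace ℝ (Fin d)) :
    Fin H → X → A → ℝ :=
  fun h x a => inner ℝ (θ h) (M.φ h x a)

/-- The class of the functions `(x, a) ↦ ⟨φ(x, a), w⟩` with `φ ∈ Φ` and `‖w‖ ≤ R`. -/
def linearClass (Φ : Finset (X → A → EuclideanSpace ℝ (Fin d))) (R : ℝ) : Set (X → A → ℝ) :=
  {g | ∃ φ ∈ Φ, ∃ w : EuclideanSpace ℝ (Fin d), ‖w‖ ≤ R ∧ g = fun x a => inner ℝ (φ x a) w}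

/-! ### PSDP -/

/-- `n` observations `(x, a, R)`. -/
abbrev Dataset (X A : Type*) (n : ℕ) := Fin n → X × A × ℝ

def squareLoss {n : ℕ} (D : Dataset X A n) (g : X → A → ℝ) : ℝ :=
  ∑ i, (g (D i).1 (D i).2.1 - (D i).2.2) ^ 2

/-- A way of resolving, measurably, the choices left open by the `argmin` and the `argmax` of PSDP
with function classes `G`: `fit t D` is a least-squares solution in `G t` for the dataset `D`,
and `act t D x` is an action that maximizes `fit t D x`. -/
structure Selection (G : Fin H → Set (X → A → ℝ)) (n : ℕ) where
  fit : Fin H → Dataset X A n → X → A → ℝ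
  fit_mem : ∀ t D, fit t D ∈ G t
  fit_min : ∀ t D, ∀ g ∈ G t, squareLoss D (fit t D) ≤ squareLoss D g
  act : Fin H → Dataset X A n → X → A
  act_max : ∀ t D x a, fit t D x a ≤ fit t D x (act t D x)
  fit_measurable : ∀ t a, Measurable fun p : Dataset X A n × X => fit t p.1 p.2 a
  act_measurable : ∀ t, Measurable fun p : Dataset X A n × X => act t p.1 p.2

section Policies

variable [Nonempty A]

/-- `π_unif`. -/
def unifPolicy [Fintype A] [MeasurableSingletonClass A] : Policy X A :=
  ⟨Kernel.const X (uniformOn Set.univ),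
    haveI : IsProbabilityMeasure (uniformOn (Set.univ : Set A)) :=
      isProbabilityMeasure_uniformOn Set.finite_univ Set.univ_nonempty
    inferInstance⟩

open Classical in
/-- `π ∘_t π'`: play `π` on the layers before `t`, and `π'` from layer `t` on. -/
def concat (M : LowRankMDP X A d H) (π : Policy X A) (t : ℕ) (π' : Policy X A) : Policy X A :=
  ⟨Kernel.piecewise (s := {x | (M.layer x : ℕ) < t})
      (M.layer_measurable (MeasurableSet.of_discrete (s := {j : Fin H | (j : ℕ) < t}))) π.1 π'.1,
    haveI := π.2
    haveI := π'.2
    inferInstance⟩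

/-- The action that the greedy policy learned from the datasets `D` of the last `k` layers
`H - k, …, H - 1` (in this order) takes at a state `x` of layer `j`. On the earlier layers this
policy is not defined by the algorithm (and never played); an arbitrary action stands in. -/
def learnedAct {G : Fin H → Set (X → A → ℝ)} {n : ℕ} (S : Selection G n) {k : ℕ}
    (D : Fin k → Dataset X A n) (j : Fin H) (x : X) : A :=
  if hj : H - k ≤ (j : ℕ) then S.act j (D ⟨(j : ℕ) - (H - k), by omega⟩) x
  else Classical.arbitrary A

lemma learnedAct_measurable {G : Fin H → Set (X → A → ℝ)} {n : ℕ} (S : Selection G n) {k : ℕ}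
    (D : Fin k → Dataset X A n) (j : Fin H) : Measurable (learnedAct S D j) := by
  unfold learnedAct
  split_ifs with hj
  · exact (S.act_measurable j).comp measurable_prodMk_left
  · exact measurable_const

/-- The partial policy `π̂^{(t)}`, `t = H - k`, learned from the datasets of the last `k` layers. -/
def learnedPolicy (M : LowRankMDP X A d H) {G : Fin H → Set (X → A → ℝ)} {n : ℕ}
    (S : Selection G n) {k : ℕ} (D : Fin k → Dataset X A n) : Policy X A :=
  ⟨Kernel.deterministic (fun x => learnedAct S D (M.layer x) x)
      ((measurable_from_prod_countable_right (f := fun p : Fin H × X => learnedAct S D p.1 p.2)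
        (learnedAct_measurable S D)).comp (M.layer_measurable.prodMk measurable_id)),
    inferInstance⟩

variable [Fintype A] [MeasurableSingletonClass A]

/-- The law of one observation `(x_t, a_t, ∑_{ℓ ≥ t} r_ℓ(x_ℓ, a_ℓ))` under
`π ∘_t π_unif ∘_{t+1} π'`, with `π ∼ P`. -/
def sampleLaw (M : LowRankMDP X A d H) (r : Fin H → X → A → ℝ) (P : PolicyDist X A) (t : Fin H)
    (π' : Policy X A) : Measure (X × A × ℝ) :=
  P.law.bind fun i =>
    (M.trajLaw (concat M (P.policy i) t (concat M unifPolicy (t + 1) π'))).map fun τ =>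
      ((τ t).1, (τ t).2, ∑ l with t ≤ l, r l (τ l).1 (τ l).2)

/-- The joint law of the datasets that `PSDP(H, r, G, P, n)` has drawn after its first `k` rounds,
that is, those of the layers `H - k, …, H - 1`. In the next round `n` independent observations are
drawn at the layer `t = H - k - 1`, with the policy learned from the earlier datasets played after
layer `t`. -/
def psdpLaw (M : LowRankMDP X A d H) (r : Fin H → X → A → ℝ) {G : Fin H → Set (X → A → ℝ)}
    {n : ℕ} (S : Selection G n) (P : Fin H → PolicyDist X A) :
    (k : ℕ) → k ≤ H → Measure (Fin k → Dataset X A n)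
  | 0, _ => Measure.dirac Fin.elim0
  | k + 1, hk =>
    let t : Fin H := ⟨H - (k + 1), by omega⟩
    (psdpLaw M r S P k (by omega)).bind fun D =>
      (Measure.pi fun _ : Fin n => sampleLaw M r (P t) t (learnedPolicy M S D)).map fun D' =>
        Fin.cons (α := fun _ => Dataset X A n) D' D

end Policies

end

end LowRank

namespace LowRank

/-! ### Dynamics -/

section Dynamics

variable {X A : Type*} [MeasurableSpace X] [MeasurableSpace A] {d H : ℕ}

/-! The argument is a reduction of planning to `H` regression problems, with three ingredients.

Decomposition. By `performance_difference`, the value of a competitor `π` exceeds that of the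
learned policy by at most the sum over the layers `t` of the mean advantage of `π` at the states
that `π` itself visits, measured with the action values `Q` of the learned policy. The learned
action maximizes the fitted function `g`, so this advantage is at most the error of `g` at the
action of `π` plus its error at the greedy action.

Change of measure (`exists_covered_set`, `integral_advantage_le`). The regression controls `g - Q`
only under the state law of the cover. Where the occupancy of `π` is at most `1 / α` times that of
the cover, the squared error transfers at the price `1 / α`. Elsewhere in the layer the occupancy is
at most `ε ‖μ‖`. Since the norm of `μ` integrates to at most `2 d √d` over a layer
(`integral_norm_μ_le`), these states have small mass and the trivial bound on the advantage
suffices.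

Regression (`measure_fitError_lt_le`). The transition density is linear in `φ⋆`, so with linear
rewards the function `Q` of every policy is linear in `φ⋆` with a weight of norm at most `2 H √d`
(`exists_qValue_eq_inner`): the least-squares problem is well specified. The return has conditional
mean `Q`, so the excess square loss of `g` has mean `∫ (g - Q)²` and a second moment bounded by a
multiple of that mean. A Bernstein bound then gives the rate `1 / n` for the squared error,
uniformly over `Φ` and a finite grid of weights (`least_squares_bound`). Sampling the action
uniformly costs the factor `A` (the number of actions).

The target `Q` of a round depends on the data of the earlier rounds, but given these data the new
samples are independent and the regression bound holds for every fixed continuation policy.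
`psdpLaw_badData_le` therefore adds up the failure probabilities of the rounds. -/

instance policy_markov (π : Policy X A) : IsMarkovKernel π.1 := π.2

/-- The policy `x ↦ κ (z, x)` with parameter `z`. -/
noncomputable def sectionPolicy {Z : Type*} [MeasurableSpace Z] (κ : Kernel (Z × X) A)
    [IsMarkovKernel κ] (z : Z) : Policy X A :=
  ⟨κ.comap (fun x => (z, x)) measurable_prodMk_left, inferInstance⟩

/-- Policies are random in two ways: an index drawn from a cover, and the datasets behind the
learned policy. Joint measurability in the parameter and the starting state serves both. One step of
the rollout is unfolded at a time, and each integral is taken against a kernel in the parameter and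
the earlier variables. -/
theorem measurable_rollout_section (M : LowRankMDP X A d H) {Z : Type*} [MeasurableSpace Z]
    (κ : Kernel (Z × X) A) [IsMarkovKernel κ] (k : ℕ) :
    Measurable fun p : Z × X => M.rollout (sectionPolicy κ p.1) k p.2 := by
  induction k with
  | zero => simp only [LowRankMDP.rollout, Kernel.const_apply]; exact measurable_const
  | succ k ih =>
    refine Measure.measurable_of_measurable_coe _ fun s hs => ?_
    have hi : Measurable (s.indicator (1 : (Fin (k + 1) → X × A) → ENNReal)) :=
      measurable_one.indicator hs
    simp_rw [← lintegral_indicator_one hs, LowRankMDP.lintegral_rollout_succ _ _ _ _ hi]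
    let R : Kernel (Z × X) (Fin k → X × A) := ⟨_, ih⟩
    have : IsMarkovKernel R := ⟨fun p => LowRankMDP.rollout_markov M _ k |>.isProbabilityMeasure _⟩
    change Measurable fun p : Z × X => ∫⁻ a, ∫⁻ y, ∫⁻ τ, s.indicator 1 (Fin.cons (p.2, a) τ)
      ∂(R (p.1, y)) ∂(M.T (p.2, a)) ∂(κ p)
    refine Measurable.lintegral_kernel_prod_right ?_
    have m1 : Measurable fun q : (Z × X) × A => (q.1.2, q.2) := by fun_prop
    change Measurable fun q : (Z × X) × A => ∫⁻ y, ∫⁻ τ, s.indicator 1 (Fin.cons (q.1.2, q.2) τ)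
      ∂(R (q.1.1, y)) ∂(M.T.comap _ m1 q)
    refine Measurable.lintegral_kernel_prod_right ?_
    have m2 : Measurable fun q : ((Z × X) × A) × X => (q.1.1.1, q.2) := by fun_prop
    change Measurable fun q : ((Z × X) × A) × X =>
      ∫⁻ τ, s.indicator 1 (Fin.cons (α := fun _ => X × A) (q.1.1.2, q.1.2) τ) ∂(R.comap _ m2 q)
    refine Measurable.lintegral_kernel_prod_right ?_
    refine hi.comp ?_
    exact LowRankMDP.measurable_cons.comp
      (f := fun q : (((Z × X) × A) × X) × (Fin k → X × A) => ((q.1.1.1.2, q.1.1.2), q.2))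
      (by fun_prop)

theorem measurable_trajLaw_section (M : LowRankMDP X A d H) {Z : Type*} [MeasurableSpace Z]
    (κ : Kernel (Z × X) A) [IsMarkovKernel κ] :
    Measurable fun z => M.trajLaw (sectionPolicy κ z) := by
  refine Measure.measurable_of_measurable_coe _ fun s hs => ?_
  simp_rw [LowRankMDP.trajLaw, Measure.bind_apply hs (Kernel.aemeasurable _)]
  exact Measurable.lintegral_prod_right
    ((Measure.measurable_coe hs).comp (measurable_rollout_section M κ H))

/-- The transition kernel of the states when `π` is played. -/
noncomputable def stepKernel (M : LowRankMDP X A d H) (π : Policy X A) : Kernel X X :=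
  M.T ∘ₖ (Kernel.id ×ₖ π.1)

instance (M : LowRankMDP X A d H) (π : Policy X A) : IsMarkovKernel (stepKernel M π) := by
  unfold stepKernel; infer_instance

theorem lintegral_stepKernel (M : LowRankMDP X A d H) (π : Policy X A) (x : X) {f : X → ENNReal}
    (hf : Measurable f) :
    ∫⁻ y, f y ∂(stepKernel M π x) = ∫⁻ a, ∫⁻ y, f y ∂(M.T (x, a)) ∂(π.1 x) := by
  rw [stepKernel, Kernel.lintegral_comp _ _ _ hf, Kernel.lintegral_id_prod hf.lintegral_kernel]

/-- The law of the state after `t` steps, as an iterate of the transition kernel. -/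
noncomputable def stateAt (M : LowRankMDP X A d H) (π : Policy X A) (t : ℕ) : Measure X :=
  (fun m : Measure X => m.bind (stepKernel M π))^[t] M.ρ

theorem stateAt_succ (M : LowRankMDP X A d H) (π : Policy X A) (t : ℕ) :
    stateAt M π (t + 1) = (stateAt M π t).bind (stepKernel M π) :=
  Function.iterate_succ_apply' _ _ _

instance stateAt_prob (M : LowRankMDP X A d H) (π : Policy X A) (t : ℕ) :
    IsProbabilityMeasure (stateAt M π t) := by
  induction t with
  | zero => exact M.ρ_prob
  | succ t ih => rw [stateAt_succ]; infer_instance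

/-- This is the Markov property at time `t`. The initial law is kept general so that the induction
can absorb the first transition into it. -/
theorem lintegral_rollout_tail (M : LowRankMDP X A d H) (π : Policy X A) {k : ℕ}
    {f : (Fin k → X × A) → ENNReal} (hf : Measurable f) (t : ℕ) : ∀ (m : ℕ) (hm : t + k = m)
    (ρ : Measure X),
    ∫⁻ x, ∫⁻ τ, f (fun i => τ ⟨t + i, by omega⟩) ∂(M.rollout π m x) ∂ρ =
      ∫⁻ x, ∫⁻ τ, f τ ∂(M.rollout π k x)
        ∂((fun m : Measure X => m.bind (stepKernel M π))^[t] ρ) := by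
  induction t with
  | zero =>
    intro m hm ρ
    obtain rfl : k = m := by omega
    simp
  | succ t ih =>
    intro m hm ρ
    obtain ⟨m, rfl⟩ : ∃ m', m = m' + 1 := ⟨m - 1, by omega⟩
    have mt : Measurable fun τ : Fin m → X × A => f fun i => τ ⟨t + i, by omega⟩ :=
      hf.comp (measurable_pi_iff.2 fun i => measurable_pi_apply _)
    rw [Function.iterate_succ_apply, ← ih m (by omega),
      Measure.lintegral_bind (Kernel.aemeasurable _) mt.lintegral_kernel.aemeasurable]
    refine lintegral_congr fun x => ?_
    rw [LowRankMDP.lintegral_rollout_succ, lintegral_stepKernel _ _ _ mt.lintegral_kernel]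
    · refine lintegral_congr fun a => lintegral_congr fun y => lintegral_congr fun τ => ?_
      congr 1
      funext i
      have : (⟨t + 1 + i, by omega⟩ : Fin (m + 1)) = Fin.succ ⟨t + i, by omega⟩ := by
        ext; simp; omega
      rw [this, Fin.cons_succ]
    · exact hf.comp (measurable_pi_iff.2 fun i => measurable_pi_apply _)

theorem lintegral_trajLaw_tail (M : LowRankMDP X A d H) (π : Policy X A) {k : ℕ}
    {f : (Fin k → X × A) → ENNReal} (hf : Measurable f) (t : ℕ) (h : t + k = H) :
    ∫⁻ τ, f (fun i => τ ⟨t + i, by omega⟩) ∂(M.trajLaw π) =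
      ∫⁻ x, ∫⁻ τ, f τ ∂(M.rollout π k x) ∂(stateAt M π t) := by
  rw [LowRankMDP.trajLaw, Measure.lintegral_bind (Kernel.aemeasurable _)]
  · exact lintegral_rollout_tail M π hf t H h M.ρ
  · exact (hf.comp (measurable_pi_iff.2 fun i => measurable_pi_apply _)).aemeasurable

theorem stateLaw_eq_stateAt (M : LowRankMDP X A d H) (π : Policy X A) (t : Fin H) :
    M.stateLaw π t = stateAt M π t := by
  refine Measure.ext_of_lintegral _ fun f hf => ?_
  obtain ⟨k, hk⟩ : ∃ k, (t : ℕ) + (k + 1) = H := ⟨H - t - 1, by omega⟩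
  have := lintegral_trajLaw_tail M π (f := fun τ : Fin (k + 1) → X × A => f (τ 0).1)
    (hf.comp (measurable_fst.comp (measurable_pi_apply 0))) t hk
  have m : Measurable fun τ : Fin H → X × A => (τ t).1 :=
    measurable_fst.comp (measurable_pi_apply t)
  rw [LowRankMDP.stateLaw, lintegral_map hf m]
  simpa [LowRankMDP.lintegral_rollout_zero _ _ _ _ hf] using this

theorem stateAt_layer (M : LowRankMDP X A d H) (π : Policy X A) (t : Fin H) :
    ∀ᵐ x ∂(stateAt M π t), M.layer x = t := by
  have hs : MeasurableSet {x | M.layer x = t} := M.layer_measurable (measurableSet_singleton t)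
  have m : Measurable fun τ : Fin H → X × A => (τ t).1 :=
    measurable_fst.comp (measurable_pi_apply t)
  rw [← stateLaw_eq_stateAt, LowRankMDP.stateLaw, ae_map_iff m.aemeasurable hs]
  exact LowRankMDP.ae_layer M π t t.2

/-- By layering, the states met before time `t` lie in earlier layers, so the actions chosen
elsewhere cannot influence the state at time `t`. With `rollout_congr`, its counterpart for the
future, this splits a concatenated policy into its phases. -/
theorem stateAt_congr (M : LowRankMDP X A d H) {π π' : Policy X A} (t : ℕ) (ht : t < H)
    (h : ∀ x, (M.layer x : ℕ) < t → π.1 x = π'.1 x) : stateAt M π t = stateAt M π' t := by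
  induction t with
  | zero => simp only [stateAt, Function.iterate_zero_apply]
  | succ t ih =>
    have e := ih (by omega) fun x hx => h x (by omega)
    rw [stateAt_succ, stateAt_succ, ← e]
    refine Measure.bind_congr_right ?_
    filter_upwards [stateAt_layer M π ⟨t, by omega⟩] with x hx
    refine Measure.ext_of_lintegral _ fun f hf => ?_
    rw [lintegral_stepKernel _ _ _ hf, lintegral_stepKernel _ _ _ hf, h x (by rw [hx]; simp)]

theorem rollout_congr (M : LowRankMDP X A d H) {π π' : Policy X A} {j : ℕ}
    (h : ∀ x, j ≤ (M.layer x : ℕ) → π.1 x = π'.1 x) (k : ℕ) : ∀ x, j ≤ (M.layer x : ℕ) →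
    (M.layer x : ℕ) + k ≤ H → M.rollout π k x = M.rollout π' k x := by
  induction k with
  | zero => intros; rfl
  | succ k ih =>
    intro x hx hk
    refine Measure.ext_of_lintegral _ fun f hf => ?_
    rw [LowRankMDP.lintegral_rollout_succ _ _ _ _ hf, LowRankMDP.lintegral_rollout_succ _ _ _ _ hf,
      h x hx]
    refine lintegral_congr fun a => ?_
    -- On the last layer the transition kernel is unconstrained, so `T_layer` is unavailable; but
    -- then no step remains and both rollouts are trivial.
    rcases Nat.eq_zero_or_pos k with rfl | hk'
    · rfl
    refine lintegral_congr_ae ?_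
    filter_upwards [M.T_layer x a (by omega)] with y hy
    rw [ih y (by omega) (by omega)]

theorem integral_rollout_succ (M : LowRankMDP X A d H) (π : Policy X A) (k : ℕ) (x : X)
    {f : (Fin (k + 1) → X × A) → ℝ} (hf : Measurable f) {C : ℝ} (hC : ∀ τ, |f τ| ≤ C) :
    ∫ τ, f τ ∂(M.rollout π (k + 1) x) =
      ∫ a, ∫ y, ∫ τ, f (Fin.cons (x, a) τ) ∂(M.rollout π k y) ∂(M.T (x, a)) ∂(π.1 x) := by
  have hc : Measurable fun p : (X × A) × (Fin k → X × A) =>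
      f (Fin.cons (α := fun _ => X × A) p.1 p.2) := hf.comp LowRankMDP.measurable_cons
  have hi : ∀ (m : Measure ((X × A) × (Fin k → X × A))) [IsProbabilityMeasure m],
      Integrable (fun p => f (Fin.cons (α := fun _ => X × A) p.1 p.2)) m := fun m _ =>
    .of_bound hc.aestronglyMeasurable C (.of_forall fun p => hC _)
  have hs : StronglyMeasurable fun p : X × A => ∫ τ, f (Fin.cons p τ)
      ∂((M.rollout π k ∘ₖ M.T) p) :=
    StronglyMeasurable.integral_kernel_prod_right' hc.stronglyMeasurable
  have key : ∀ p : X × A, ∫ q, f (Fin.cons (α := fun _ => X × A) q.1 q.2)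
      ∂((Kernel.id ×ₖ (M.rollout π k ∘ₖ M.T)) p) =
      ∫ τ, f (Fin.cons p τ) ∂((M.rollout π k ∘ₖ M.T) p) := by
    intro p
    rw [Kernel.prod_apply, Kernel.id_apply, Measure.dirac_prod,
      integral_map measurable_prodMk_left.aemeasurable hc.aestronglyMeasurable]
  rw [LowRankMDP.rollout, Kernel.map_apply _ LowRankMDP.measurable_cons,
    integral_map LowRankMDP.measurable_cons.aemeasurable hf.aestronglyMeasurable,
    Kernel.integral_comp (hi _)]
  simp_rw [key]
  rw [Kernel.prod_apply, Kernel.id_apply, Measure.dirac_prod,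
    integral_map measurable_prodMk_left.aemeasurable hs.aestronglyMeasurable]
  refine integral_congr_ae (.of_forall fun a => ?_)
  exact Kernel.integral_comp (.of_bound
    (hc.comp measurable_prodMk_left).aestronglyMeasurable C (.of_forall fun p => hC _))

/-! ### Values -/

/-- The expected sum of the rewards `r` over the next `k` steps. -/
noncomputable def rolloutValue (M : LowRankMDP X A d H) (r : X × A → ℝ) (π : Policy X A) (k : ℕ)
    (x : X) : ℝ :=
  ∫ τ, ∑ i, r (τ i) ∂(M.rollout π k x)

/-- The expected sum of the rewards over the next `k + 1` steps, when the first action is `a`. -/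
noncomputable def qValue (M : LowRankMDP X A d H) (r : X × A → ℝ) (π : Policy X A) (k : ℕ)
    (x : X) (a : A) : ℝ :=
  r (x, a) + ∫ y, rolloutValue M r π k y ∂(M.T (x, a))

theorem measurable_sum_rewards {r : X × A → ℝ} (hr : Measurable r) (k : ℕ) :
    Measurable fun τ : Fin k → X × A => ∑ i, r (τ i) :=
  Finset.measurable_sum _ fun i _ => hr.comp (measurable_pi_apply i)

theorem abs_sum_rewards_le {X A : Type*} {r : X × A → ℝ} (h1 : ∀ p, |r p| ≤ 1) {k : ℕ} (τ : Fin k → X × A) :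
    |∑ i, r (τ i)| ≤ k :=
  (Finset.abs_sum_le_sum_abs _ _).trans
    ((Finset.sum_le_sum fun i _ => h1 (τ i)).trans (by simp))

theorem measurable_rolloutValue (M : LowRankMDP X A d H) {r : X × A → ℝ} (hr : Measurable r)
    (π : Policy X A) (k : ℕ) : Measurable (rolloutValue M r π k) :=
  (StronglyMeasurable.integral_kernel (measurable_sum_rewards hr k).stronglyMeasurable).measurable

theorem abs_rolloutValue_le (M : LowRankMDP X A d H) {r : X × A → ℝ} (h1 : ∀ p, |r p| ≤ 1)
    (π : Policy X A) (k : ℕ) (x : X) : |rolloutValue M r π k x| ≤ k := by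
  have := norm_integral_le_of_norm_le_const (μ := M.rollout π k x) (C := (k : ℝ))
    (f := fun τ => ∑ i, r (τ i))
    (.of_forall fun τ => abs_sum_rewards_le h1 τ)
  simpa [rolloutValue] using this

theorem measurable_qValue (M : LowRankMDP X A d H) {r : X × A → ℝ} (hr : Measurable r)
    (π : Policy X A) (k : ℕ) : Measurable fun p : X × A => qValue M r π k p.1 p.2 :=
  hr.add (StronglyMeasurable.integral_kernel
    (measurable_rolloutValue M hr π k).stronglyMeasurable).measurable

theorem abs_qValue_le (M : LowRankMDP X A d H) {r : X × A → ℝ} (h1 : ∀ p, |r p| ≤ 1)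
    (π : Policy X A) (k : ℕ) (x : X) (a : A) : |qValue M r π k x a| ≤ k + 1 := by
  have := norm_integral_le_of_norm_le_const (μ := M.T (x, a)) (C := (k : ℝ))
    (f := rolloutValue M r π k)
    (.of_forall fun y => abs_rolloutValue_le M h1 π k y)
  refine (abs_add_le _ _).trans ?_
  have h2 := h1 (x, a)
  simp only [probReal_univ, mul_one, Real.norm_eq_abs] at this
  linarith

theorem integrable_rolloutValue (M : LowRankMDP X A d H) {r : X × A → ℝ} (hr : Measurable r)
    (h1 : ∀ p, |r p| ≤ 1) (π : Policy X A) (k : ℕ) (m : Measure X) [IsFiniteMeasure m] :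
    Integrable (rolloutValue M r π k) m :=
  .of_bound (measurable_rolloutValue M hr π k).aestronglyMeasurable k
    (.of_forall fun y => abs_rolloutValue_le M h1 π k y)

theorem integral_cons_rewards (M : LowRankMDP X A d H) {r : X × A → ℝ} (hr : Measurable r)
    (h1 : ∀ p, |r p| ≤ 1) (π : Policy X A) (k : ℕ) (x : X) (a : A) :
    ∫ y, ∫ τ, (r (x, a) + ∑ i, r (τ i)) ∂(M.rollout π k y) ∂(M.T (x, a)) = qValue M r π k x a := by
  have : ∀ y, ∫ τ, (r (x, a) + ∑ i, r (τ i)) ∂(M.rollout π k y) =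
      r (x, a) + rolloutValue M r π k y := by
    intro y
    rw [integral_add (integrable_const _), rolloutValue]
    · simp
    · exact .of_bound (measurable_sum_rewards hr k).aestronglyMeasurable k
        (.of_forall fun τ => abs_sum_rewards_le h1 τ)
  simp_rw [this]
  rw [integral_add (integrable_const _) (integrable_rolloutValue M hr h1 π k _), qValue]
  simp

theorem rolloutValue_zero (M : LowRankMDP X A d H) (r : X × A → ℝ) (π : Policy X A) (x : X) :
    rolloutValue M r π 0 x = 0 := by simp [rolloutValue]

theorem rolloutValue_succ (M : LowRankMDP X A d H) {r : X × A → ℝ} (hr : Measurable r)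
    (h1 : ∀ p, |r p| ≤ 1) (π : Policy X A) (k : ℕ) (x : X) :
    rolloutValue M r π (k + 1) x = ∫ a, qValue M r π k x a ∂(π.1 x) := by
  rw [rolloutValue, integral_rollout_succ M π k x (measurable_sum_rewards hr _)
    (fun τ => abs_sum_rewards_le h1 τ)]
  refine integral_congr_ae (.of_forall fun a => ?_)
  simp only [Fin.sum_univ_succ, Fin.cons_zero, Fin.cons_succ]
  exact integral_cons_rewards M hr h1 π k x a

theorem rolloutValue_congr (M : LowRankMDP X A d H) (r : X × A → ℝ) {π π' : Policy X A} {j : ℕ}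
    (h : ∀ x, j ≤ (M.layer x : ℕ) → π.1 x = π'.1 x) (k : ℕ) (x : X) (hx : j ≤ (M.layer x : ℕ))
    (hk : (M.layer x : ℕ) + k ≤ H) : rolloutValue M r π k x = rolloutValue M r π' k x := by
  rw [rolloutValue, rolloutValue, rollout_congr M h k x hx hk]

/-- An action value at layer `j` involves the policy only after layer `j`. This is why later rounds
of PSDP, which define the policy on earlier layers, leave the regression targets of past rounds
unchanged. -/
theorem qValue_congr (M : LowRankMDP X A d H) (r : X × A → ℝ) {π π' : Policy X A} {j : ℕ}
    (h : ∀ x, j + 1 ≤ (M.layer x : ℕ) → π.1 x = π'.1 x) (k : ℕ) (x : X)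
    (hx : (M.layer x : ℕ) = j) (hk : j + 1 + k ≤ H) (a : A) :
    qValue M r π k x a = qValue M r π' k x a := by
  unfold qValue
  rcases Nat.eq_zero_or_pos k with rfl | hk'
  · simp [rolloutValue_zero]
  congr 1
  refine integral_congr_ae ?_
  filter_upwards [M.T_layer x a (by omega)] with y hy
  exact rolloutValue_congr M r h k y (by omega) (by omega)

end Dynamics

/-! ### Sampling -/

section Sampling

variable {X A : Type*} [MeasurableSpace X] [MeasurableSpace A] {d H : ℕ}

theorem integral_bind_kernel {α β : Type*} [MeasurableSpace α] [MeasurableSpace β]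
    {m : Measure α} [SFinite m] {κ : Kernel α β} [IsSFiniteKernel κ] {f : β → ℝ}
    (hf : Integrable f (m.bind κ)) :
    ∫ y, f y ∂(m.bind κ) = ∫ x, ∫ y, f y ∂(κ x) ∂m := by
  rw [Measure.comp_eq_comp_const_apply] at hf ⊢
  rw [Kernel.integral_comp hf, Kernel.const_apply]

/-- Boxes form a generating π-system, and on a box the product measure is a finite product of
measurable functions of the parameter. -/
theorem measurable_pi_const {α β : Type*} [MeasurableSpace α] [MeasurableSpace β] (n : ℕ)
    {m : α → Measure β} (hm : Measurable m) [∀ a, IsProbabilityMeasure (m a)] :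
    Measurable fun a => Measure.pi fun _ : Fin n => m a := by
  refine Measurable.measure_of_isPiSystem_of_isProbabilityMeasure generateFrom_pi.symm
    isPiSystem_pi ?_
  rintro _ ⟨s, hs, rfl⟩
  simp only [Set.mem_pi, Set.mem_univ, forall_true_left, Set.mem_ofPred_eq] at hs
  simp_rw [Measure.pi_pi]
  exact Finset.measurable_prod _ fun i _ => (Measure.measurable_coe (hs i)).comp hm

/-- The rewards `r_h`, as a single function of the state and the action. -/
def layerReward (M : LowRankMDP X A d H) (r : Fin H → X → A → ℝ) (p : X × A) : ℝ :=
  r (M.layer p.1) p.1 p.2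

theorem measurable_layerReward [Countable A] [MeasurableSingletonClass A]
    (M : LowRankMDP X A d H) {r : Fin H → X → A → ℝ} (hr : ∀ h a, Measurable fun x => r h x a) :
    Measurable (layerReward M r) := by
  refine measurable_from_prod_countable_left fun a => ?_
  exact (measurable_from_prod_countable_right (f := fun p : Fin H × X => r p.1 p.2 a)
    (fun h => hr h a)).comp (M.layer_measurable.prodMk measurable_id)

/-- The state at time `h` almost surely lies in layer `h`, so rewards indexed by time can be
replaced by one reward function of the state-action pair, for which the recursion over rollouts is
stated. -/
theorem value_eq_integral_rolloutValue [Countable A] [MeasurableSingletonClass A]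
    (M : LowRankMDP X A d H) {r : Fin H → X → A → ℝ} (hr : ∀ h a, Measurable fun x => r h x a)
    (h1 : ∀ p, |layerReward M r p| ≤ 1) (π : Policy X A) :
    M.value r π = ∫ x, rolloutValue M (layerReward M r) π H x ∂M.ρ := by
  have e : M.value r π = ∫ τ, ∑ h, layerReward M r (τ h) ∂(M.trajLaw π) := by
    refine integral_congr_ae ?_
    have : ∀ᵐ τ ∂(M.trajLaw π), ∀ h : Fin H, M.layer (τ h).1 = h :=
      ae_all_iff.2 fun h => LowRankMDP.ae_layer M π h h.2
    filter_upwards [this] with τ hτ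
    refine Finset.sum_congr rfl fun h _ => ?_
    rw [layerReward, hτ h]
  rw [e, LowRankMDP.trajLaw, integral_bind_kernel]
  · rfl
  · exact .of_bound (measurable_sum_rewards (measurable_layerReward M hr) H).aestronglyMeasurable H
      (.of_forall fun τ => abs_sum_rewards_le h1 τ)

theorem measurable_stateAt_section (M : LowRankMDP X A d H) {Z : Type*} [MeasurableSpace Z]
    (κ : Kernel (Z × X) A) [IsMarkovKernel κ] (t : Fin H) :
    Measurable fun z => stateAt M (sectionPolicy κ z) t := by
  have m : Measurable fun τ : Fin H → X × A => (τ t).1 :=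
    measurable_fst.comp (measurable_pi_apply t)
  simp_rw [← stateLaw_eq_stateAt, LowRankMDP.stateLaw]
  exact (Measure.measurable_map _ m).comp (measurable_trajLaw_section M κ)

theorem measurable_stateAt_policy (M : LowRankMDP X A d H) (P : PolicyDist X A) (t : Fin H) :
    Measurable fun i => stateAt M (P.policy i) t :=
  measurable_stateAt_section M P.kernel t

/-- The law of the state at layer `t` when a policy drawn from `P` is played. -/
noncomputable def mixState (M : LowRankMDP X A d H) (P : PolicyDist X A) (t : Fin H) : Measure X :=
  P.law.bind fun i => stateAt M (P.policy i) t

instance mixState_prob (M : LowRankMDP X A d H) (P : PolicyDist X A) (t : Fin H) :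
    IsProbabilityMeasure (mixState M P t) :=
  isProbabilityMeasure_bind (measurable_stateAt_policy M P t).aemeasurable
    (.of_forall fun _ => inferInstance)

theorem lintegral_mixState (M : LowRankMDP X A d H) (P : PolicyDist X A) (t : Fin H)
    {f : X → ENNReal} (hf : Measurable f) :
    ∫⁻ x, f x ∂(mixState M P t) = ∫⁻ i, ∫⁻ x, f x ∂(stateAt M (P.policy i) t) ∂P.law :=
  Measure.lintegral_bind (measurable_stateAt_policy M P t).aemeasurable hf.aemeasurable

theorem mixState_layer (M : LowRankMDP X A d H) (P : PolicyDist X A) (t : Fin H) :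
    ∀ᵐ x ∂(mixState M P t), M.layer x = t := by
  have hs : MeasurableSet {x | M.layer x ≠ t} :=
    M.layer_measurable (MeasurableSet.of_discrete (s := {j : Fin H | j ≠ t}))
  rw [ae_iff, ← lintegral_indicator_one hs,
    lintegral_mixState M P t (measurable_one.indicator hs)]
  simp_rw [lintegral_indicator_one hs]
  have : ∀ i, stateAt M (P.policy i) t {x | M.layer x ≠ t} = 0 := fun i =>
    ae_iff.1 (stateAt_layer M (P.policy i) t)
  simp [this]

theorem concat_apply_of_lt (M : LowRankMDP X A d H) (π π' : Policy X A) {t : ℕ} {x : X}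
    (hx : (M.layer x : ℕ) < t) : (concat M π t π').1 x = π.1 x := by
  simp [concat, Kernel.piecewise_apply, hx]

theorem concat_apply_of_le (M : LowRankMDP X A d H) (π π' : Policy X A) {t : ℕ} {x : X}
    (hx : t ≤ (M.layer x : ℕ)) : (concat M π t π').1 x = π'.1 x := by
  simp [concat, Kernel.piecewise_apply, not_lt.2 hx]

open Classical in
theorem measurable_trajLaw_concat (M : LowRankMDP X A d H) (P : PolicyDist X A) (t : ℕ)
    (π' : Policy X A) : Measurable fun i => M.trajLaw (concat M (P.policy i) t π') := by
  have hs : MeasurableSet {p : P.Idx × X | (M.layer p.2 : ℕ) < t} :=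
    (M.layer_measurable.comp measurable_snd)
      (MeasurableSet.of_discrete (s := {j : Fin H | (j : ℕ) < t}))
  let κ : Kernel (P.Idx × X) A := Kernel.piecewise hs P.kernel (π'.1.comap Prod.snd measurable_snd)
  have e : ∀ i, concat M (P.policy i) t π' = sectionPolicy κ i := fun i => by
    refine Subtype.ext (Kernel.ext fun x => ?_)
    simp [concat, sectionPolicy, PolicyDist.policy, κ, Kernel.piecewise_apply]
  simp_rw [e]
  exact measurable_trajLaw_section M κ

theorem sum_filter_rewards (g : Fin H → ℝ) (t : Fin H) (k : ℕ) (hk : (t : ℕ) + (k + 1) = H) :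
    ∑ l with t ≤ l, g l = ∑ i : Fin (k + 1), g ⟨t + i, by omega⟩ := by
  symm
  refine Finset.sum_bij (fun (i : Fin (k + 1)) _ => (⟨t + i, by omega⟩ : Fin H)) ?_ ?_ ?_ ?_
  · exact fun i _ => Finset.mem_filter.2 ⟨Finset.mem_univ _, Fin.le_def.2 (Nat.le_add_right _ _)⟩
  · intro i _ j _ h
    have h' := congrArg Fin.val h
    exact Fin.ext (by simpa using h')
  · intro l hl
    simp only [Finset.mem_filter, Finset.mem_univ, true_and, Fin.le_def] at hl
    exact ⟨⟨l - t, by omega⟩, Finset.mem_univ _, by ext; simp; omega⟩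
  · intros; rfl

/-- The law of the return over `k + 1` steps from a state-action pair. -/
noncomputable def returnKernel (M : LowRankMDP X A d H) (r : X × A → ℝ) (π : Policy X A) (k : ℕ) :
    Kernel (X × A) ℝ :=
  (Kernel.id ×ₖ (M.rollout π k ∘ₖ M.T)).map fun q => r q.1 + ∑ i, r (q.2 i)

theorem measurable_return {r : X × A → ℝ} (hr : Measurable r) (k : ℕ) :
    Measurable fun q : (X × A) × (Fin k → X × A) => r q.1 + ∑ i, r (q.2 i) :=
  (hr.comp measurable_fst).add ((measurable_sum_rewards hr k).comp measurable_snd)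

theorem lintegral_returnKernel (M : LowRankMDP X A d H) {r : X × A → ℝ} (hr : Measurable r)
    (π : Policy X A) (k : ℕ) (p : X × A) {f : ℝ → ENNReal} (hf : Measurable f) :
    ∫⁻ s, f s ∂(returnKernel M r π k p) =
      ∫⁻ y, ∫⁻ τ, f (r p + ∑ i, r (τ i)) ∂(M.rollout π k y) ∂(M.T p) := by
  have m : Measurable fun q : (X × A) × (Fin k → X × A) => f (r q.1 + ∑ i, r (q.2 i)) :=
    hf.comp (measurable_return hr k)
  rw [returnKernel, Kernel.map_apply _ (measurable_return hr k),
    lintegral_map hf (measurable_return hr k), Kernel.lintegral_id_prod m, Kernel.lintegral_comp]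
  exact m.comp measurable_prodMk_left

theorem isMarkovKernel_returnKernel (M : LowRankMDP X A d H) {r : X × A → ℝ} (hr : Measurable r)
    (π : Policy X A) (k : ℕ) : IsMarkovKernel (returnKernel M r π k) :=
  Kernel.IsMarkovKernel.map _ (measurable_return hr k)

theorem abs_returnKernel_le (M : LowRankMDP X A d H) {r : X × A → ℝ} (hr : Measurable r)
    (h1 : ∀ p, |r p| ≤ 1) (π : Policy X A) (k : ℕ) (p : X × A) :
    ∀ᵐ s ∂(returnKernel M r π k p), |s| ≤ (k : ℝ) + 1 := by
  rw [returnKernel, Kernel.map_apply _ (measurable_return hr k),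
    ae_map_iff (measurable_return hr k).aemeasurable
      (measurableSet_le (by fun_prop) measurable_const)]
  refine .of_forall fun q => (abs_add_le _ _).trans ?_
  linarith [h1 q.1, abs_sum_rewards_le h1 q.2]

theorem integral_returnKernel (M : LowRankMDP X A d H) {r : X × A → ℝ} (hr : Measurable r)
    (h1 : ∀ p, |r p| ≤ 1) (π : Policy X A) (k : ℕ) (p : X × A) :
    ∫ s, s ∂(returnKernel M r π k p) = qValue M r π k p.1 p.2 := by
  have hc := measurable_return hr k
  rw [returnKernel, Kernel.map_apply _ hc, integral_map hc.aemeasurable (by fun_prop),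
    Kernel.prod_apply, Kernel.id_apply, Measure.dirac_prod,
    integral_map measurable_prodMk_left.aemeasurable hc.aestronglyMeasurable, Kernel.integral_comp]
  · exact integral_cons_rewards M hr h1 π k p.1 p.2
  · refine .of_bound (hc.comp measurable_prodMk_left).aestronglyMeasurable (k + 1)
      (.of_forall fun τ => (abs_add_le _ _).trans ?_)
    have := h1 p
    have := abs_sum_rewards_le h1 τ
    simp only
    linarith

variable [Nonempty A] [Fintype A] [MeasurableSingletonClass A]

/-- Layering separates the three phases of the sampling policy: up to layer `t` it induces the state
law of the drawn cover policy, at `t` the action is uniform, and afterwards the rollout is that of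
`π'`. -/
theorem lintegral_sampleLaw (M : LowRankMDP X A d H) {r : Fin H → X → A → ℝ}
    (hr : ∀ h a, Measurable fun x => r h x a) (P : PolicyDist X A) (t : Fin H) (k : ℕ)
    (hk : (t : ℕ) + (k + 1) = H) (π' : Policy X A) {f : X × A × ℝ → ENNReal} (hf : Measurable f) :
    ∫⁻ z, f z ∂(sampleLaw M r P t π') =
      ∫⁻ x, ∫⁻ a, ∫⁻ y, ∫⁻ τ, f (x, a, layerReward M r (x, a) + ∑ i, layerReward M r (τ i))
        ∂(M.rollout π' k y) ∂(M.T (x, a)) ∂(uniformOn Set.univ) ∂(mixState M P t) := by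
  have hr' := measurable_layerReward M hr
  have hru : ∀ l, Measurable fun p : X × A => r l p.1 p.2 := fun l =>
    measurable_from_prod_countable_left fun a => hr l a
  have mt : Measurable fun τ : Fin H → X × A =>
      ((τ t).1, (τ t).2, ∑ l with t ≤ l, r l (τ l).1 (τ l).2) := by
    refine (measurable_fst.comp (measurable_pi_apply t)).prodMk
      ((measurable_snd.comp (measurable_pi_apply t)).prodMk ?_)
    exact Finset.measurable_sum _ fun l _ => (hru l).comp (measurable_pi_apply l)
  have mf : Measurable fun τ : Fin (k + 1) → X × A =>
      f ((τ 0).1, (τ 0).2, ∑ i, layerReward M r (τ i)) :=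
    hf.comp ((measurable_fst.comp (measurable_pi_apply 0)).prodMk
      ((measurable_snd.comp (measurable_pi_apply 0)).prodMk (measurable_sum_rewards hr' _)))
  have mF : Measurable fun p : X × A => ∫⁻ y, ∫⁻ τ,
      f (p.1, p.2, layerReward M r p + ∑ i, layerReward M r (τ i))
        ∂(M.rollout π' k y) ∂(M.T p) := by
    refine Measurable.lintegral_kernel_prod_right ?_
    have m2 : Measurable fun q : (X × A) × X => q.2 := measurable_snd
    change Measurable fun q : (X × A) × X => ∫⁻ τ,
      f (q.1.1, q.1.2, layerReward M r q.1 + ∑ i, layerReward M r (τ i))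
        ∂((M.rollout π' k).comap _ m2 q)
    refine Measurable.lintegral_kernel_prod_right ?_
    refine hf.comp ((by fun_prop : Measurable _).prodMk ((by fun_prop : Measurable _).prodMk ?_))
    exact (hr'.comp (by fun_prop)).add ((measurable_sum_rewards hr' k).comp measurable_snd)
  rw [lintegral_mixState M P t
    (Measurable.lintegral_prod_right' (f := fun p : X × A => ∫⁻ y, ∫⁻ τ,
      f (p.1, p.2, layerReward M r p + ∑ i, layerReward M r (τ i))
        ∂(M.rollout π' k y) ∂(M.T p)) mF),
    sampleLaw, Measure.lintegral_bind _ hf.aemeasurable]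
  swap
  · exact ((Measure.measurable_map _ mt).comp (measurable_trajLaw_concat M P t _)).aemeasurable
  refine lintegral_congr fun i => ?_
  set π := concat M (P.policy i) t (concat M unifPolicy (t + 1) π') with hπ
  rw [lintegral_map hf mt]
  have e1 : ∫⁻ τ, f ((τ t).1, (τ t).2, ∑ l with t ≤ l, r l (τ l).1 (τ l).2) ∂(M.trajLaw π) =
      ∫⁻ τ, (fun τ' : Fin (k + 1) → X × A => f ((τ' 0).1, (τ' 0).2, ∑ i, layerReward M r (τ' i)))
        (fun i => τ ⟨t + i, by omega⟩) ∂(M.trajLaw π) := by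
    refine lintegral_congr_ae ?_
    have : ∀ᵐ τ ∂(M.trajLaw π), ∀ h : Fin H, M.layer (τ h).1 = h :=
      ae_all_iff.2 fun h => LowRankMDP.ae_layer M π h h.2
    filter_upwards [this] with τ hτ
    rw [sum_filter_rewards _ t k hk]
    simp [layerReward, hτ]
  rw [e1, lintegral_trajLaw_tail M π mf t hk,
    stateAt_congr M (π := π) (π' := P.policy i) t t.2 fun x hx => concat_apply_of_lt M _ _ hx]
  refine lintegral_congr_ae ?_
  filter_upwards [stateAt_layer M (P.policy i) t] with x hx
  rw [LowRankMDP.lintegral_rollout_succ _ _ _ _ mf]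
  have eu : π.1 x = uniformOn Set.univ := by
    rw [hπ, concat_apply_of_le M _ _ (by rw [hx]), concat_apply_of_lt M _ _ (by rw [hx]; omega)]
    rfl
  rw [eu]
  refine lintegral_congr fun a => ?_
  simp only [Fin.cons_zero, Fin.sum_univ_succ, Fin.cons_succ]
  rcases Nat.eq_zero_or_pos k with rfl | hk'
  · rfl
  refine lintegral_congr_ae ?_
  filter_upwards [M.T_layer x a (by rw [hx]; omega)] with y hy
  rw [rollout_congr M (π := π) (π' := π') (j := t + 1) _ k y (by rw [hy, hx])
    (by rw [hy, hx]; omega)]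
  intro z hz
  rw [hπ, concat_apply_of_le M _ _ (by omega), concat_apply_of_le M _ _ hz]

instance uniformOn_univ_prob : IsProbabilityMeasure (uniformOn (Set.univ : Set A)) :=
  isProbabilityMeasure_uniformOn Set.finite_univ Set.univ_nonempty

theorem sampleLaw_prob (M : LowRankMDP X A d H) {r : Fin H → X → A → ℝ}
    (hr : ∀ h a, Measurable fun x => r h x a) (P : PolicyDist X A) (t : Fin H)
    (π' : Policy X A) : IsProbabilityMeasure (sampleLaw M r P t π') := by
  obtain ⟨k, hk⟩ : ∃ k, (t : ℕ) + (k + 1) = H := ⟨H - t - 1, by omega⟩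
  constructor
  rw [← lintegral_one, lintegral_sampleLaw M hr P t k hk π' measurable_const]
  simp

theorem measurable_sampleLaw_section (M : LowRankMDP X A d H) {r : Fin H → X → A → ℝ}
    (hr : ∀ h a, Measurable fun x => r h x a) (P : PolicyDist X A) (t : Fin H)
    {Z : Type*} [MeasurableSpace Z] (κ : Kernel (Z × X) A) [IsMarkovKernel κ] :
    Measurable fun z => sampleLaw M r P t (sectionPolicy κ z) := by
  obtain ⟨k, hk⟩ : ∃ k, (t : ℕ) + (k + 1) = H := ⟨H - t - 1, by omega⟩
  have hr' := measurable_layerReward M hr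
  refine Measure.measurable_of_measurable_coe _ fun s hs => ?_
  have hi : Measurable (s.indicator (1 : X × A × ℝ → ENNReal)) := measurable_one.indicator hs
  simp_rw [← lintegral_indicator_one hs, lintegral_sampleLaw M hr P t k hk _ hi]
  let R : Kernel (Z × X) (Fin k → X × A) := ⟨_, measurable_rollout_section M κ k⟩
  have : IsMarkovKernel R := ⟨fun p => LowRankMDP.rollout_markov M _ k |>.isProbabilityMeasure _⟩
  refine Measurable.lintegral_prod_right ?_
  refine Measurable.lintegral_prod_right'
    (f := fun q : (Z × X) × A => ∫⁻ y, ∫⁻ τ, s.indicator (1 : X × A × ℝ → ENNReal)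
      (q.1.2, q.2, layerReward M r (q.1.2, q.2) + ∑ i, layerReward M r (τ i))
      ∂(R (q.1.1, y)) ∂(M.T (q.1.2, q.2))) ?_
  have m1 : Measurable fun q : (Z × X) × A => (q.1.2, q.2) := by fun_prop
  change Measurable fun q : (Z × X) × A => ∫⁻ y, ∫⁻ τ, s.indicator (1 : X × A × ℝ → ENNReal)
      (q.1.2, q.2, layerReward M r (q.1.2, q.2) + ∑ i, layerReward M r (τ i))
      ∂(R (q.1.1, y)) ∂(M.T.comap _ m1 q)
  refine Measurable.lintegral_kernel_prod_right ?_
  have m2 : Measurable fun q : ((Z × X) × A) × X => (q.1.1.1, q.2) := by fun_prop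
  change Measurable fun q : ((Z × X) × A) × X => ∫⁻ τ, s.indicator (1 : X × A × ℝ → ENNReal)
      (q.1.1.2, q.1.2, layerReward M r (q.1.1.2, q.1.2) + ∑ i, layerReward M r (τ i))
      ∂(R.comap _ m2 q)
  refine Measurable.lintegral_kernel_prod_right ?_
  refine hi.comp ((by fun_prop : Measurable _).prodMk ((by fun_prop : Measurable _).prodMk ?_))
  exact (hr'.comp (by fun_prop)).add ((measurable_sum_rewards hr' k).comp measurable_snd)

/-- This disintegrates a sample into its state-action pair and the conditional law of the return.
The conditional mean is the action value, so the regression function is identified. -/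
theorem sampleLaw_eq_compProd (M : LowRankMDP X A d H) {r : Fin H → X → A → ℝ}
    (hr : ∀ h a, Measurable fun x => r h x a) (P : PolicyDist X A) (t : Fin H) (k : ℕ)
    (hk : (t : ℕ) + (k + 1) = H) (π' : Policy X A) :
    sampleLaw M r P t π' =
      (((mixState M P t).prod (uniformOn Set.univ)) ⊗ₘ
        returnKernel M (layerReward M r) π' k).map fun q => (q.1.1, q.1.2, q.2) := by
  have hr' := measurable_layerReward M hr
  have := isMarkovKernel_returnKernel M hr' π' k
  have mq : Measurable fun q : (X × A) × ℝ => (q.1.1, q.1.2, q.2) := by fun_prop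
  refine Measure.ext_of_lintegral _ fun f hf => ?_
  have hfm : Measurable fun q : (X × A) × ℝ => f (q.1.1, q.1.2, q.2) := hf.comp mq
  rw [lintegral_sampleLaw M hr P t k hk π' hf, lintegral_map hf mq,
    Measure.lintegral_compProd hfm, lintegral_prod _ (Measurable.aemeasurable
      (Measurable.lintegral_kernel_prod_right' hfm))]
  refine lintegral_congr fun x => lintegral_congr fun a => ?_
  exact (lintegral_returnKernel M hr' π' k (x, a) 
    (f := fun b => f (x, a, b)) (hf.comp (by fun_prop))).symm

end Sampling

/-! ### Least squares -/

section LeastSquares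

/-- For `|u| ≤ 1` one has `exp u ≤ 1 + u + u²`. With `u = -l / (2b)` the linear term contributes
`-mean / (2b)`, while the variance hypothesis bounds the quadratic one by `mean / (4b)`, so half of
the decay survives. -/
theorem integral_exp_neg_le {Ω : Type*} [MeasurableSpace Ω] (m : Measure Ω)
    [IsProbabilityMeasure m] {l : Ω → ℝ} (hl : Measurable l) {b : ℝ} (hb : 0 < b)
    (hbd : ∀ᵐ z ∂m, |l z| ≤ b) (hvar : ∫ z, l z ^ 2 ∂m ≤ b * ∫ z, l z ∂m) :
    ∫ z, Real.exp (-(l z / (2 * b))) ∂m ≤ Real.exp (-((∫ z, l z ∂m) / (4 * b))) := by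
  have i1 : Integrable l m := .of_bound hl.aestronglyMeasurable b hbd
  have i2 : Integrable (fun z => l z ^ 2) m := by
    refine .of_bound (hl.pow_const 2).aestronglyMeasurable (b ^ 2) ?_
    filter_upwards [hbd] with z hz
    rw [Real.norm_eq_abs, abs_pow]
    gcongr
  have hpt : ∀ᵐ z ∂m, Real.exp (-(l z / (2 * b))) ≤
      1 - 1 / (2 * b) * l z + 1 / (4 * b ^ 2) * l z ^ 2 := by
    filter_upwards [hbd] with z hz
    have h1 : |-(l z / (2 * b))| ≤ 1 := by
      rw [abs_neg, abs_div, abs_of_pos (by positivity : 0 < 2 * b), div_le_one (by positivity)]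
      linarith
    have h2 := (abs_le.1 (Real.abs_exp_sub_one_sub_id_le h1)).2
    have h3 : (-(l z / (2 * b))) ^ 2 = 1 / (4 * b ^ 2) * l z ^ 2 := by field_simp; ring
    have h4 : l z / (2 * b) = 1 / (2 * b) * l z := by ring
    rw [h3] at h2
    linarith
  have hb2 : Integrable (fun z => 1 - 1 / (2 * b) * l z + 1 / (4 * b ^ 2) * l z ^ 2) m :=
    ((integrable_const _).sub (i1.const_mul _)).add (i2.const_mul _)
  calc ∫ z, Real.exp (-(l z / (2 * b))) ∂m
      ≤ ∫ z, (1 - 1 / (2 * b) * l z + 1 / (4 * b ^ 2) * l z ^ 2) ∂m :=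
        integral_mono_of_nonneg (.of_forall fun z => (Real.exp_pos _).le) hb2 hpt
    _ = 1 - 1 / (2 * b) * ∫ z, l z ∂m + 1 / (4 * b ^ 2) * ∫ z, l z ^ 2 ∂m := by
        have i3 : Integrable (fun z => 1 - 1 / (2 * b) * l z) m :=
          (integrable_const _).sub (i1.const_mul _)
        rw [integral_add i3 (i2.const_mul _),
          integral_sub (integrable_const _) (i1.const_mul _), integral_const_mul,
          integral_const_mul]
        simp
    _ ≤ 1 - 1 / (2 * b) * ∫ z, l z ∂m + 1 / (4 * b ^ 2) * (b * ∫ z, l z ∂m) := by gcongr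
    _ = -((∫ z, l z ∂m) / (4 * b)) + 1 := by field_simp; ring
    _ ≤ _ := Real.add_one_le_exp _

/-- A one-sided Bernstein bound for a variable whose variance is controlled by its mean. -/
theorem measure_sum_lt_le {Ω : Type*} [MeasurableSpace Ω] (m : Measure Ω)
    [IsProbabilityMeasure m] {l : Ω → ℝ} (hl : Measurable l) {b : ℝ} (hb : 0 < b)
    (hbd : ∀ᵐ z ∂m, |l z| ≤ b) (hvar : ∫ z, l z ^ 2 ∂m ≤ b * ∫ z, l z ∂m) (n : ℕ) (s : ℝ) :
    (Measure.pi fun _ : Fin n => m)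
      {D | ∑ i, l (D i) < n * (∫ z, l z ∂m) / 2 - 2 * b * s} ≤
      ENNReal.ofReal (Real.exp (-s)) := by
  set e := ∫ z, l z ∂m with he
  set F : (Fin n → Ω) → ℝ := fun D => ∏ i, Real.exp (-(l (D i) / (2 * b))) with hF
  have hFi : Integrable F (Measure.pi fun _ : Fin n => m) := by
    refine Integrable.fintype_prod (μ := fun _ : Fin n => m)
      (f := fun _ z => Real.exp (-(l z / (2 * b)))) fun i => ?_
    refine .of_bound (by fun_prop) (Real.exp 1) ?_
    filter_upwards [hbd] with z hz
    rw [Real.norm_eq_abs, Real.abs_exp, Real.exp_le_exp, neg_le, le_div_iff₀ (by positivity)]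
    have := (abs_le.1 hz).1
    linarith
  have hint : ∫ D, F D ∂(Measure.pi fun _ : Fin n => m) ≤ Real.exp (-(n * e / (4 * b))) := by
    rw [hF, integral_fintype_prod_eq_pow (fun z => Real.exp (-(l z / (2 * b))))]
    have h := integral_exp_neg_le m hl hb hbd hvar
    calc _ ≤ (Real.exp (-(e / (4 * b)))) ^ Fintype.card (Fin n) :=
          pow_le_pow_left₀ (integral_nonneg fun z => (Real.exp_pos _).le) h _
      _ = _ := by rw [← Real.exp_nat_mul]; simp; ring
  -- Chernoff's method: on the event, the product `F` is at least `C`, while the mean of `F` is at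
  -- most `C * exp (-s)`; Markov's inequality concludes.
  set C := Real.exp (-(n * e / (4 * b)) + s) with hC
  have hsub : {D | ∑ i, l (D i) < n * e / 2 - 2 * b * s} ⊆ {D | C ≤ F D} := by
    intro D hD
    simp only [Set.mem_ofPred_eq] at hD ⊢
    rw [hC, hF]
    simp only
    rw [← Real.exp_sum, Real.exp_le_exp, Finset.sum_neg_distrib, ← Finset.sum_div]
    have : (∑ i, l (D i)) / (2 * b) ≤ (n * e / 2 - 2 * b * s) / (2 * b) := by gcongr
    have h2 : (n * e / 2 - 2 * b * s) / (2 * b) = n * e / (4 * b) - s := by field_simp; ring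
    linarith
  have hmk := mul_meas_ge_le_integral_of_nonneg
    (.of_forall fun D => Finset.prod_nonneg fun i _ => (Real.exp_pos _).le) hFi C
  refine (measure_mono hsub).trans ?_
  rw [← ofReal_measureReal]
  refine ENNReal.ofReal_le_ofReal ?_
  have hCp : 0 < C := Real.exp_pos _
  have h3 : C * (Measure.pi fun _ : Fin n => m).real {D | C ≤ F D} ≤ C * Real.exp (-s) := by
    refine (hmk.trans hint).trans (le_of_eq ?_)
    rw [hC, ← Real.exp_add]
    ring_nf
  exact le_of_mul_le_mul_left h3 hCp

/-! ### A finite net of the weights. -/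

/-- The points of a grid of mesh `c`. -/
noncomputable def gridPoint {d : ℕ} (c : ℝ) (k : Fin d → ℤ) : EuclideanSpace ℝ (Fin d) :=
  WithLp.toLp 2 fun j => c * k j

/-- Each coordinate is rounded down to the mesh `B / (n √d)`. The `d` coordinate errors combine to
at most `B / n` in norm, and a coordinate bounded by `B` is at most `n √d` mesh widths. -/
theorem exists_gridPoint {d n : ℕ} (hd : 1 ≤ d) (hn : 1 ≤ n) {B : ℝ} (hB : 0 < B)
    (w : EuclideanSpace ℝ (Fin d)) (hw : ‖w‖ ≤ B) :
    ∃ k ∈ Fintype.piFinset fun _ : Fin d =>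
        Finset.Icc (-(⌈(n : ℝ) * √(d : ℝ)⌉₊ : ℤ)) (⌈(n : ℝ) * √(d : ℝ)⌉₊ : ℤ),
      ‖w - gridPoint (B / n / √(d : ℝ)) k‖ ≤ B / n := by
  have hd0 : (0 : ℝ) < d := by exact_mod_cast hd
  have hn0 : (0 : ℝ) < n := by exact_mod_cast hn
  have hs : 0 < √(d : ℝ) := Real.sqrt_pos.2 hd0
  set c := B / n / √(d : ℝ) with hc
  have hc0 : 0 < c := by positivity
  have hBc : B / c = n * √(d : ℝ) := by rw [hc]; field_simp
  refine ⟨fun j => ⌊w j / c⌋, ?_, ?_⟩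
  · rw [Fintype.mem_piFinset]
    intro j
    have h1 : |w j| ≤ B := (PiLp.norm_apply_le w j).trans hw
    have h2 := abs_le.1 h1
    have h3 : (n : ℝ) * √(d : ℝ) ≤ ⌈(n : ℝ) * √(d : ℝ)⌉₊ := Nat.le_ceil _
    rw [Finset.mem_Icc]
    constructor
    · rw [Int.le_floor]
      push_cast
      have : -B / c ≤ w j / c := by gcongr; exact h2.1
      rw [neg_div, hBc] at this
      linarith
    · have : w j / c ≤ B / c := by gcongr; exact h2.2
      rw [hBc] at this
      have h4 : (⌊w j / c⌋ : ℝ) ≤ (⌈(n : ℝ) * √(d : ℝ)⌉₊ : ℤ) := by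
        push_cast
        exact (Int.floor_le _).trans (this.trans h3)
      exact_mod_cast h4
  · rw [EuclideanSpace.norm_eq]
    refine Real.sqrt_le_iff.2 ⟨by positivity, ?_⟩
    have hj : ∀ j, ‖(w - gridPoint c fun j => ⌊w j / c⌋) j‖ ^ 2 ≤ c ^ 2 := by
      intro j
      have e : (w - gridPoint c fun j => ⌊w j / c⌋) j = c * Int.fract (w j / c) := by
        rw [Int.fract]
        simp only [gridPoint, PiLp.sub_apply]
        field_simp
      rw [e, norm_mul, mul_pow, Real.norm_eq_abs, Real.norm_eq_abs, sq_abs, sq_abs]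
      have f0 := Int.fract_nonneg (w j / c)
      have f1 := (Int.fract_lt_one (w j / c)).le
      have : Int.fract (w j / c) ^ 2 ≤ 1 := pow_le_one₀ f0 f1
      nlinarith [sq_nonneg c]
    refine (Finset.sum_le_sum fun j _ => hj j).trans ?_
    simp only [Finset.sum_const, Finset.card_univ, Fintype.card_fin, nsmul_eq_mul]
    rw [hc, div_pow _ (√(d : ℝ)), Real.sq_sqrt hd0.le]
    field_simp
    exact le_rfl

theorem card_grid (d m : ℕ) :
    (Fintype.piFinset fun _ : Fin d => Finset.Icc (-(m : ℤ)) (m : ℤ)).card = (2 * m + 1) ^ d := by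
  rw [Fintype.card_piFinset_const, Int.card_Icc]
  congr 1
  omega

/-- The excess square loss of `g` over `q` is, up to constants and with high probability, at
least its mean `∫ (g - q)²`, when `q` is the regression function. -/
theorem excess_loss_lower {Ω : Type*} [MeasurableSpace Ω] (m : Measure Ω)
    [IsProbabilityMeasure m] {g q R : Ω → ℝ} (hg : Measurable g) (hq : Measurable q)
    (hR : Measurable R) {B : ℝ} (hB : 0 < B) (hgB : ∀ z, |g z| ≤ 2 * B) (hqB : ∀ᵐ z ∂m, |q z| ≤ B)
    (hRB : ∀ᵐ z ∂m, |R z| ≤ B) (horth : ∫ z, (g z - q z) * (R z - q z) ∂m = 0) (n : ℕ) (s : ℝ) :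
    (Measure.pi fun _ : Fin n => m)
      {D | ∑ i, ((g (D i) - R (D i)) ^ 2 - (q (D i) - R (D i)) ^ 2) <
        n * (∫ z, (g z - q z) ^ 2 ∂m) / 2 - 50 * B ^ 2 * s} ≤ ENNReal.ofReal (Real.exp (-s)) := by
  have hi : ∀ {f : Ω → ℝ}, Measurable f → ∀ C : ℝ, (∀ᵐ z ∂m, |f z| ≤ C) → Integrable f m :=
    fun hf C h => .of_bound hf.aestronglyMeasurable C h
  have hgq : ∀ᵐ z ∂m, |g z - q z| ≤ 3 * B := by
    filter_upwards [hqB] with z h1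
    have := abs_le.1 (hgB z)
    have := abs_le.1 h1
    rw [abs_le]; constructor <;> linarith
  have hRq : ∀ᵐ z ∂m, |R z - q z| ≤ 2 * B := by
    filter_upwards [hqB, hRB] with z h1 h2
    have := abs_le.1 h2
    have := abs_le.1 h1
    rw [abs_le]; constructor <;> linarith
  have hsum : ∀ᵐ z ∂m, |g z + q z - 2 * R z| ≤ 5 * B := by
    filter_upwards [hqB, hRB] with z h1 h2
    have := abs_le.1 (hgB z)
    have := abs_le.1 h2
    have := abs_le.1 h1
    rw [abs_le]; constructor <;> linarith
  have i1 : Integrable (fun z => (g z - q z) ^ 2) m := by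
    refine hi (by fun_prop) ((3 * B) ^ 2) ?_
    filter_upwards [hgq] with z h1
    rw [abs_pow]; gcongr
  have i2 : Integrable (fun z => (g z - q z) * (R z - q z)) m := by
    refine hi (by fun_prop) (3 * B * (2 * B)) ?_
    filter_upwards [hgq, hRq] with z h1 h2
    rw [abs_mul]; gcongr
  -- Orthogonality of the residual removes the cross term, so the excess loss has mean exactly the
  -- squared distance to `q`.
  have hmean : ∫ z, ((g z - R z) ^ 2 - (q z - R z) ^ 2) ∂m = ∫ z, (g z - q z) ^ 2 ∂m := by
    have : ∀ z, (g z - R z) ^ 2 - (q z - R z) ^ 2 =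
        (g z - q z) ^ 2 - 2 * ((g z - q z) * (R z - q z)) := fun z => by ring
    simp_rw [this]
    rw [integral_sub i1 (i2.const_mul 2), integral_const_mul, horth]
    simp
  have hfac : ∀ z, (g z - R z) ^ 2 - (q z - R z) ^ 2 = (g z - q z) * (g z + q z - 2 * R z) :=
    fun z => by ring
  -- The excess loss factors as `(g - q)(g + q - 2R)` with second factor at most `5 B`. Hence its
  -- square is at most `25 B²` times `(g - q)²`, whose integral is the mean: the variance condition
  -- of `measure_sum_lt_le`, and the source of `50 B² = 2 · 25 B²`.
  have hsq : ∫ z, ((g z - R z) ^ 2 - (q z - R z) ^ 2) ^ 2 ∂m ≤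
      25 * B ^ 2 * ∫ z, ((g z - R z) ^ 2 - (q z - R z) ^ 2) ∂m := by
    rw [hmean, ← integral_const_mul]
    refine integral_mono_of_nonneg (.of_forall fun z => sq_nonneg _) (i1.const_mul _) ?_
    filter_upwards [hsum] with z h1
    rw [hfac, mul_pow, mul_comm]
    refine mul_le_mul_of_nonneg_right ?_ (sq_nonneg _)
    rw [← sq_abs]
    calc |g z + q z - 2 * R z| ^ 2 ≤ (5 * B) ^ 2 := by gcongr
      _ = _ := by ring
  have key := measure_sum_lt_le m (l := fun z => (g z - R z) ^ 2 - (q z - R z) ^ 2)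
    (by fun_prop) (b := 25 * B ^ 2) (by positivity) ?_ hsq n s
  · rw [hmean] at key
    convert key using 5
    ring
  · filter_upwards [hsum, hgq] with z h1 h2
    rw [hfac, abs_mul]
    calc |g z - q z| * |g z + q z - 2 * R z| ≤ 3 * B * (5 * B) := by gcongr
      _ ≤ _ := by nlinarith [sq_nonneg B]

theorem abs_inner_le_of_norm_le {E : Type*} [NormedAddCommGroup E] [InnerProductSpace ℝ E]
    {x w : E} {C : ℝ} (hx : ‖x‖ ≤ 1) (hw : ‖w‖ ≤ C) : |inner ℝ x w| ≤ C :=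
  (abs_real_inner_le_norm x w).trans <|
    (mul_le_mul hx hw (norm_nonneg _) zero_le_one).trans (one_mul C).le

/-- Least squares over finitely many bounded linear classes: with high probability, every function
with at most the empirical loss of the regression function `q` is close to `q`. -/
theorem least_squares_bound {Ω ι : Type*} [MeasurableSpace Ω] (m : Measure Ω)
    [IsProbabilityMeasure m] {d n : ℕ} (hd : 1 ≤ d) (hn : 1 ≤ n) (Φ : Finset ι)
    {ψ : ι → Ω → EuclideanSpace ℝ (Fin d)} (hψ : ∀ i ∈ Φ, Measurable (ψ i))
    (hψ1 : ∀ i ∈ Φ, ∀ z, ‖ψ i z‖ ≤ 1) {q R : Ω → ℝ} (hq : Measurable q) (hR : Measurable R)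
    {B : ℝ} (hB : 0 < B) (hqB : ∀ᵐ z ∂m, |q z| ≤ B) (hRB : ∀ᵐ z ∂m, |R z| ≤ B)
    (horth : ∀ i ∈ Φ, ∀ w, ∫ z, (inner ℝ (ψ i z) w - q z) * (R z - q z) ∂m = 0) (s : ℝ) :
    (Measure.pi fun _ : Fin n => m)
      {D | ∃ i ∈ Φ, ∃ w, ‖w‖ ≤ B ∧
        ∑ j, (inner ℝ (ψ i (D j)) w - R (D j)) ^ 2 ≤ ∑ j, (q (D j) - R (D j)) ^ 2 ∧
        (22 + 200 * s) * B ^ 2 / n < ∫ z, (inner ℝ (ψ i z) w - q z) ^ 2 ∂m} ≤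
      ENNReal.ofReal (Φ.card * (2 * ⌈(n : ℝ) * √(d : ℝ)⌉₊ + 1 : ℝ) ^ d * Real.exp (-s)) := by
  classical
  have hn0 : (0 : ℝ) < n := by exact_mod_cast hn
  have hn1 : (1 : ℝ) ≤ n := by exact_mod_cast hn
  set N := ⌈(n : ℝ) * √(d : ℝ)⌉₊ with hN
  set c := B / n / √(d : ℝ) with hc
  set K := Fintype.piFinset fun _ : Fin d => Finset.Icc (-(N : ℤ)) (N : ℤ) with hK
  -- Rounding a weight of norm at most `B` may leave that ball, but not the ball of radius `2 B`;
  -- grid points farther out are never needed and get the empty event.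
  set bad : ι × (Fin d → ℤ) → Set (Fin n → Ω) := fun p =>
    if ‖gridPoint c p.2‖ ≤ 2 * B then
      {D | ∑ j, ((inner ℝ (ψ p.1 (D j)) (gridPoint c p.2) - R (D j)) ^ 2 -
          (q (D j) - R (D j)) ^ 2) <
        n * (∫ z, (inner ℝ (ψ p.1 z) (gridPoint c p.2) - q z) ^ 2 ∂m) / 2 - 50 * B ^ 2 * s}
    else ∅ with hbad
  have hbadm : ∀ p ∈ Φ ×ˢ K, (Measure.pi fun _ : Fin n => m) (bad p) ≤
      ENNReal.ofReal (Real.exp (-s)) := by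
    intro p hp
    have hpΦ := (Finset.mem_product.1 hp).1
    simp only [hbad]
    split_ifs with h
    · exact excess_loss_lower m ((hψ _ hpΦ).inner measurable_const) hq hR hB
        (fun z => abs_inner_le_of_norm_le (hψ1 _ hpΦ z) h) hqB hRB (horth _ hpΦ _) n s
    · simp
  have hae : ∀ᵐ D ∂(Measure.pi fun _ : Fin n => m), ∀ j, |R (D j)| ≤ B :=
    ae_all_iff.2 fun j => (Measure.quasiMeasurePreserving_eval (fun _ : Fin n => m) j).ae hRB
  calc _ ≤ (Measure.pi fun _ : Fin n => m) (⋃ p ∈ Φ ×ˢ K, bad p) := by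
        refine measure_mono_ae ?_
        filter_upwards [hae] with D hD
        rintro ⟨i, hi, w, hw, hle, hlt⟩
        obtain ⟨k, hk, hkw⟩ := exists_gridPoint hd hn hB w hw
        refine Set.mem_iUnion₂.2 ⟨(i, k), Finset.mem_product.2 ⟨hi, hk⟩, ?_⟩
        rw [← hc] at hkw
        have hηB : B / n ≤ B := div_le_self hB.le hn1
        have hk2 : ‖gridPoint c k‖ ≤ 2 * B := by
          have := norm_sub_norm_le (gridPoint c k) w
          rw [norm_sub_rev] at this
          linarith
        simp only [hbad, if_pos hk2, Set.mem_ofPred_eq]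
        set w' := gridPoint c k with hw'
        have hdiff : ∀ z, |inner ℝ (ψ i z) w' - inner ℝ (ψ i z) w| ≤ B / n := by
          intro z
          rw [← inner_sub_right]
          refine abs_inner_le_of_norm_le (hψ1 i hi z) ?_
          rwa [norm_sub_rev]
        -- Replacing `w` by its grid point changes each squared residual by at most `(B / n) · 5B`,
        -- hence the total loss by at most `5 B²`.
        have hsum : ∑ j, ((inner ℝ (ψ i (D j)) w' - R (D j)) ^ 2 - (q (D j) - R (D j)) ^ 2) ≤
            5 * B ^ 2 := by
          have h1 : ∀ j, (inner ℝ (ψ i (D j)) w' - R (D j)) ^ 2 ≤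
              (inner ℝ (ψ i (D j)) w - R (D j)) ^ 2 + B / n * (5 * B) := by
            intro j
            have a1 := hdiff (D j)
            have a2 : |inner ℝ (ψ i (D j)) w' + inner ℝ (ψ i (D j)) w - 2 * R (D j)| ≤ 5 * B := by
              have b1 := abs_le.1 (abs_inner_le_of_norm_le (hψ1 i hi (D j)) hk2)
              have b2 := abs_le.1 (abs_inner_le_of_norm_le (hψ1 i hi (D j)) hw)
              have b3 := abs_le.1 (hD j)
              rw [abs_le]; constructor <;> linarith
            have a3 : (inner ℝ (ψ i (D j)) w' - inner ℝ (ψ i (D j)) w) *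
                (inner ℝ (ψ i (D j)) w' + inner ℝ (ψ i (D j)) w - 2 * R (D j)) ≤
                B / n * (5 * B) := by
              refine (le_abs_self _).trans ?_
              rw [abs_mul]
              gcongr
            linarith
          have h2 := Finset.sum_le_sum fun j (_ : j ∈ Finset.univ) => h1 j
          rw [Finset.sum_add_distrib] at h2
          simp only [Finset.sum_const, Finset.card_univ, Fintype.card_fin, nsmul_eq_mul] at h2
          rw [Finset.sum_sub_distrib]
          have : (n : ℝ) * (B / n * (5 * B)) = 5 * B ^ 2 := by field_simp
          linarith
        have hmean : ∫ z, (inner ℝ (ψ i z) w - q z) ^ 2 ∂m ≤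
            2 * ∫ z, (inner ℝ (ψ i z) w' - q z) ^ 2 ∂m + 2 * (B / n) ^ 2 := by
          have mi : ∀ v, Measurable fun z => inner ℝ (ψ i z) v := fun v =>
            (hψ i hi).inner measurable_const
          have hint : Integrable (fun z => (inner ℝ (ψ i z) w' - q z) ^ 2) m := by
            refine .of_bound (((mi w').sub hq).pow_const 2).aestronglyMeasurable ((3 * B) ^ 2) ?_
            filter_upwards [hqB] with z h1
            rw [Real.norm_eq_abs, abs_pow]
            gcongr
            have b1 := abs_le.1 (abs_inner_le_of_norm_le (hψ1 i hi z) hk2)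
            have b2 := abs_le.1 h1
            rw [abs_le]; constructor <;> linarith
          have : 2 * ∫ z, (inner ℝ (ψ i z) w' - q z) ^ 2 ∂m + 2 * (B / n) ^ 2 =
              ∫ z, (2 * (inner ℝ (ψ i z) w' - q z) ^ 2 + 2 * (B / n) ^ 2) ∂m := by
            rw [integral_add (hint.const_mul 2) (integrable_const _), integral_const_mul]
            simp
          rw [this]
          refine integral_mono_of_nonneg (.of_forall fun z => sq_nonneg _)
            ((hint.const_mul 2).add (integrable_const _)) (.of_forall fun z => ?_)
          have a1 : (inner ℝ (ψ i z) w' - inner ℝ (ψ i z) w) ^ 2 ≤ (B / n) ^ 2 := by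
            rw [← sq_abs]
            gcongr
            exact hdiff z
          simp only
          nlinarith [sq_nonneg ((inner ℝ (ψ i z) w' - q z) +
            (inner ℝ (ψ i z) w' - inner ℝ (ψ i z) w))]
        -- The constants are forced here: multiplying by `n` and halving twice turns `(22 + 200 s)
        -- B² - 2 B²` into `5 B² + 50 B² s`, that is, the cost of rounding plus the deviation term.
        refine lt_of_le_of_lt hsum ?_
        have h5 : (22 + 200 * s) * B ^ 2 / n <
            2 * ∫ z, (inner ℝ (ψ i z) w' - q z) ^ 2 ∂m + 2 * (B / n) ^ 2 := hlt.trans_le hmean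
        have h6 : (n : ℝ) * ((22 + 200 * s) * B ^ 2 / n) = (22 + 200 * s) * B ^ 2 := by field_simp
        have h7 : (n : ℝ) * (B / n) ^ 2 ≤ B ^ 2 := by
          have : (n : ℝ) * (B / n) ^ 2 = B * (B / n) := by field_simp
          rw [this, sq]
          gcongr
        have h8 := mul_lt_mul_of_pos_left h5 hn0
        rw [h6] at h8
        linarith
    _ ≤ ∑ p ∈ Φ ×ˢ K, (Measure.pi fun _ : Fin n => m) (bad p) := measure_biUnion_finset_le _ _
    _ ≤ ∑ p ∈ Φ ×ˢ K, ENNReal.ofReal (Real.exp (-s)) := Finset.sum_le_sum hbadm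
    _ = _ := by
        rw [Finset.sum_const, Finset.card_product, hK, card_grid, nsmul_eq_mul,
          ENNReal.ofReal_mul (by positivity)]
        congr 1
        rw [← ENNReal.ofReal_natCast]
        push_cast
        rfl

end LeastSquares

/-! ### Linear structure and coverage -/

section Structure

variable {X A : Type*} [MeasurableSpace X] [MeasurableSpace A] {d H : ℕ}

theorem measurableSet_layer (M : LowRankMDP X A d H) (h : Fin H) :
    MeasurableSet {x | M.layer x = h} := M.layer_measurable (measurableSet_singleton h)

theorem integrable_smul_μ (M : LowRankMDP X A d H) (h : Fin H) {f : X → ℝ} (hf : Measurable f)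
    {C : ℝ} (hC : ∀ x, |f x| ≤ C) :
    Integrable (fun x => f x • M.μ h x) (M.ν.restrict {x | M.layer x = h}) :=
  (M.μ_integrable h).bdd_smul C hf.aestronglyMeasurable (.of_forall hC)

/-- The normalization of `μ⋆` only concerns weights in `[0, 1]`. Positive and negative parts are
rescaled into this range separately, whence the factor 2. -/
theorem norm_integral_smul_μ_le (M : LowRankMDP X A d H) (h : Fin H) {f : X → ℝ}
    (hf : Measurable f) {C : ℝ} (hC0 : 0 < C) (hC : ∀ x, |f x| ≤ C) :
    ‖∫ x in {x | M.layer x = h}, f x • M.μ h x ∂M.ν‖ ≤ 2 * C * √(d : ℝ) := by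
  have key : ∀ g : X → ℝ, Measurable g → (∀ x, |g x| ≤ C) →
      ‖∫ x in {x | M.layer x = h}, max (g x) 0 • M.μ h x ∂M.ν‖ ≤ C * √(d : ℝ) := by
    intro g hg hgC
    have hN := M.μ_normalized h (fun x => max (g x) 0 / C) ((hg.max measurable_const).div_const C)
      fun x => ⟨by positivity, by
        rw [div_le_one hC0]
        exact max_le ((le_abs_self _).trans (hgC x)) hC0.le⟩
    have e : ∫ x in {x | M.layer x = h}, max (g x) 0 • M.μ h x ∂M.ν =
        C • ∫ x in {x | M.layer x = h}, (max (g x) 0 / C) • M.μ h x ∂M.ν := by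
      rw [← integral_smul]
      refine integral_congr_ae (.of_forall fun x => ?_)
      simp only [smul_smul]
      congr 1
      field_simp
    rw [e, norm_smul, Real.norm_eq_abs, abs_of_pos hC0]
    gcongr
  have i1 : ∀ g : X → ℝ, Measurable g → (∀ x, |g x| ≤ C) →
      Integrable (fun x => max (g x) 0 • M.μ h x) (M.ν.restrict {x | M.layer x = h}) :=
    fun g hg hgC => integrable_smul_μ M h (hg.max measurable_const) (C := C) fun x => by
      rw [abs_of_nonneg (le_max_right _ _)]
      exact max_le ((le_abs_self _).trans (hgC x)) hC0.le
  have hneg : ∀ x, |(-f x)| ≤ C := fun x => by rw [abs_neg]; exact hC x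
  have e : ∫ x in {x | M.layer x = h}, f x • M.μ h x ∂M.ν =
      ∫ x in {x | M.layer x = h}, max (f x) 0 • M.μ h x ∂M.ν -
      ∫ x in {x | M.layer x = h}, max (-f x) 0 • M.μ h x ∂M.ν := by
    rw [← integral_sub (i1 f hf hC) (i1 (fun x => -f x) hf.neg hneg)]
    refine integral_congr_ae (.of_forall fun x => ?_)
    simp only [← sub_smul]
    congr 1
    rcases le_total 0 (f x) with h0 | h0
    · rw [max_eq_left h0, max_eq_right (by linarith)]; ring
    · rw [max_eq_right h0, max_eq_left (by linarith)]; ring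
  rw [e]
  refine (norm_sub_le _ _).trans ?_
  have h1 := key f hf hC
  have h2 := key (fun x => -f x) hf.neg hneg
  linarith

theorem norm_le_sum_abs (v : EuclideanSpace ℝ (Fin d)) : ‖v‖ ≤ ∑ i, |v i| := by
  have := (EuclideanSpace.basisFun (Fin d) ℝ).sum_repr v
  calc ‖v‖ = ‖∑ i, v i • EuclideanSpace.basisFun (Fin d) ℝ i‖ := by
        conv_lhs => rw [← this]
        rfl
    _ ≤ ∑ i, ‖v i • EuclideanSpace.basisFun (Fin d) ℝ i‖ := norm_sum_le _ _
    _ = _ := by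
        refine Finset.sum_congr rfl fun i _ => ?_
        rw [norm_smul, OrthonormalBasis.norm_eq_one, mul_one, Real.norm_eq_abs]

/-- The integral of the absolute value of coordinate `i` is coordinate `i` of the integral of `μ`
against the sign of that coordinate, hence at most `2 √d`. Summing over coordinates gives the
`d^{3/2}` of the final bound. -/
theorem integral_norm_μ_le (M : LowRankMDP X A d H) (h : Fin H) :
    ∫ x in {x | M.layer x = h}, ‖M.μ h x‖ ∂M.ν ≤ 2 * (d * √(d : ℝ)) := by
  have mμ : ∀ i, Measurable fun x => M.μ h x i := fun i =>
    (by fun_prop : Measurable fun v : EuclideanSpace ℝ (Fin d) => v i).comp (M.μ_measurable h)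
  have iμ : ∀ i, Integrable (fun x => |M.μ h x i|) (M.ν.restrict {x | M.layer x = h}) := fun i =>
    Integrable.mono' (Integrable.norm (M.μ_integrable h)) (mμ i).norm.aestronglyMeasurable (.of_forall fun x => by
      simp only [Real.norm_eq_abs, abs_abs]
      exact PiLp.norm_apply_le (M.μ h x) i)
  have coord : ∀ i, ∫ x in {x | M.layer x = h}, |M.μ h x i| ∂M.ν ≤ 2 * √(d : ℝ) := by
    intro i
    set s : X → ℝ := fun x => if 0 ≤ M.μ h x i then 1 else -1 with hs
    have ms : Measurable s := Measurable.ite (measurableSet_le measurable_const (mμ i))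
      measurable_const measurable_const
    have bs : ∀ x, |s x| ≤ 1 := fun x => by simp only [hs]; split_ifs <;> simp
    have e : ∫ x in {x | M.layer x = h}, |M.μ h x i| ∂M.ν =
        (∫ x in {x | M.layer x = h}, s x • M.μ h x ∂M.ν) i := by
      have := (EuclideanSpace.proj i : EuclideanSpace ℝ (Fin d) →L[ℝ] ℝ).integral_comp_comm
        (integrable_smul_μ M h ms bs)
      change _ = (EuclideanSpace.proj i : EuclideanSpace ℝ (Fin d) →L[ℝ] ℝ) _
      rw [← this]
      refine integral_congr_ae (.of_forall fun x => ?_)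
      simp only [PiLp.proj_apply, PiLp.smul_apply, smul_eq_mul, hs]
      split_ifs with h0
      · rw [abs_of_nonneg h0, one_mul]
      · rw [abs_of_neg (not_le.1 h0)]; ring
    rw [e]
    refine (le_abs_self _).trans ?_
    rw [← Real.norm_eq_abs]
    refine (PiLp.norm_apply_le _ i).trans ?_
    simpa using norm_integral_smul_μ_le M h ms one_pos bs
  calc ∫ x in {x | M.layer x = h}, ‖M.μ h x‖ ∂M.ν
      ≤ ∫ x in {x | M.layer x = h}, ∑ i, |M.μ h x i| ∂M.ν :=
        integral_mono (M.μ_integrable h).norm (integrable_finsetSum _ fun i _ => iμ i)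
          fun x => norm_le_sum_abs _
    _ = ∑ i, ∫ x in {x | M.layer x = h}, |M.μ h x i| ∂M.ν := integral_finsetSum _ fun i _ => iμ i
    _ ≤ ∑ _i : Fin d, 2 * √(d : ℝ) := Finset.sum_le_sum fun i _ => coord i
    _ = _ := by simp; ring

/-- The low-rank structure enters here: the density is an inner product, so the feature vector can
be pulled out of the expectation of any bounded function of the next state. -/
theorem integral_T_eq_inner (M : LowRankMDP X A d H) {h h' : Fin H} (hh : (h' : ℕ) = h + 1)
    {f : X → ℝ} (hf : Measurable f) {C : ℝ} (hC : ∀ x, |f x| ≤ C) {x : X} (hx : M.layer x = h)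
    (a : A) :
    ∫ y, f y ∂(M.T (x, a)) =
      inner ℝ (M.φ h x a) (∫ y in {y | M.layer y = h'}, f y • M.μ h' y ∂M.ν) := by
  have hS := measurableSet_layer M h'
  have hT : ∀ᵐ y ∂(M.T (x, a)), y ∈ {y | M.layer y = h'} := by
    filter_upwards [M.T_layer x a (by rw [hx]; omega)] with y hy
    exact Fin.ext (by rw [hy, hx, hh])
  have md : Measurable fun y => ENNReal.ofReal (inner ℝ (M.μ h' y) (M.φ h x a)) :=
    ENNReal.measurable_ofReal.comp ((M.μ_measurable h').inner measurable_const)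
  rw [← Measure.restrict_eq_self_of_ae_mem hT, M.T_eq h h' hh x hx a, restrict_withDensity hS,
    integral_withDensity_eq_integral_toReal_smul md (.of_forall fun y => ENNReal.ofReal_lt_top),
    ← integral_inner (integrable_smul_μ M h' hf hC)]
  refine integral_congr_ae (.of_forall fun y => ?_)
  simp only
  rw [ENNReal.toReal_ofReal (M.density_nonneg h h' hh x hx a y), inner_smul_right, smul_eq_mul,
    real_inner_comm, mul_comm]

/-- With linear rewards, the action values of any policy are linear in the true features. -/
theorem exists_qValue_eq_inner (M : LowRankMDP X A d H)
    (hd : 1 ≤ d) {θ : Fin H → EuclideanSpace ℝ (Fin d)} (hθ : ∀ h, ‖θ h‖ ≤ 1)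
    (hr : Measurable (layerReward M (linearReward M θ)))
    (h1 : ∀ p, |layerReward M (linearReward M θ) p| ≤ 1) (π : Policy X A) (t : Fin H) (k : ℕ)
    (hk : (t : ℕ) + (k + 1) = H) :
    ∃ w : EuclideanSpace ℝ (Fin d), ‖w‖ ≤ 2 * (H : ℝ) * √(d : ℝ) ∧
      ∀ x, M.layer x = t → ∀ a,
        qValue M (layerReward M (linearReward M θ)) π k x a = inner ℝ (M.φ t x a) w := by
  have hsd : 1 ≤ √(d : ℝ) := Real.one_le_sqrt.2 (by exact_mod_cast hd)
  have hH : (k : ℝ) + 1 ≤ H := by exact_mod_cast (by omega : k + 1 ≤ H)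
  -- On the last layer there is no next layer to integrate over, and the weight is `θ t` alone.
  -- Otherwise the weight has norm at most `1 + 2 k √d`, which is at most `2 (k + 1) √d`.
  rcases Nat.eq_zero_or_pos k with rfl | hk0
  · refine ⟨θ t, (hθ t).trans ?_, fun x hx a => ?_⟩
    · simp only [CharP.cast_eq_zero] at hH
      nlinarith
    · simp [qValue, rolloutValue_zero, layerReward, linearReward, hx, real_inner_comm]
  · let t' : Fin H := ⟨t + 1, by omega⟩
    have mV := measurable_rolloutValue M hr π k
    have bV := abs_rolloutValue_le M h1 π k
    have hk0' : (0 : ℝ) < k := by exact_mod_cast hk0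
    refine ⟨θ t + ∫ y in {y | M.layer y = t'},
      rolloutValue M (layerReward M (linearReward M θ)) π k y • M.μ t' y ∂M.ν, ?_, fun x hx a => ?_⟩
    · refine (norm_add_le _ _).trans ?_
      have := norm_integral_smul_μ_le M t' mV hk0' bV
      have := hθ t
      nlinarith
    · rw [qValue, integral_T_eq_inner M (h := t) (h' := t') rfl mV bV hx a, inner_add_right]
      simp [layerReward, linearReward, hx, real_inner_comm]

/-! ### Occupancies and coverage. -/

/-- The mean of the features at layer `g` under `π`. -/
noncomputable def meanFeature (M : LowRankMDP X A d H) (π : Policy X A) (g : Fin H) :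
    EuclideanSpace ℝ (Fin d) :=
  ∫ τ, M.φ g (τ g).1 (τ g).2 ∂(M.trajLaw π)

theorem ae_norm_feature_le (M : LowRankMDP X A d H) (π : Policy X A) (g : Fin H) :
    ∀ᵐ τ ∂(M.trajLaw π), ‖M.φ g (τ g).1 (τ g).2‖ ≤ 1 := by
  filter_upwards [LowRankMDP.ae_layer M π g g.2] with τ hτ
  exact M.φ_norm g _ _ hτ

theorem norm_meanFeature_le (M : LowRankMDP X A d H) (π : Policy X A) (g : Fin H) :
    ‖meanFeature M π g‖ ≤ 1 := by
  simpa [meanFeature] using norm_integral_le_of_norm_le_const (ae_norm_feature_le M π g)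

theorem occupancy_eq_inner (M : LowRankMDP X A d H) (π : Policy X A) {g h : Fin H}
    (hgh : (h : ℕ) = g + 1) (x : X) :
    M.occupancy π h x = inner ℝ (M.μ h x) (meanFeature M π g) := by
  obtain rfl : g = ⟨(h : ℕ) - 1, lt_of_le_of_lt (Nat.sub_le _ _) h.2⟩ := by ext; simp; omega
  rw [LowRankMDP.occupancy, if_neg (by omega)]
  rfl

/-- A real supremum over an unbounded family defaults to 0, so boundedness has to be supplied: mean
features have norm at most 1, and Cauchy–Schwarz bounds all occupancies by `‖μ‖`. -/
theorem occupancy_le_iSup (M : LowRankMDP X A d H) (π : Policy X A) {g h : Fin H}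
    (hgh : (h : ℕ) = g + 1) (x : X) : M.occupancy π h x ≤ ⨆ π' : Policy X A, M.occupancy π' h x := by
  refine le_ciSup (f := fun π' : Policy X A => M.occupancy π' h x) ⟨‖M.μ h x‖, ?_⟩ π
  rintro _ ⟨π', rfl⟩
  simp only [occupancy_eq_inner M π' hgh]
  refine (real_inner_le_norm _ _).trans ?_
  exact mul_le_of_le_one_right (norm_nonneg _) (norm_meanFeature_le M π' g)

theorem measurable_occupancy (M : LowRankMDP X A d H) (π : Policy X A) {g h : Fin H}
    (hgh : (h : ℕ) = g + 1) : Measurable (M.occupancy π h) := by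
  rw [show M.occupancy π h = _ from funext (occupancy_eq_inner M π hgh)]
  exact (M.μ_measurable h).inner measurable_const

variable [Fintype A] [MeasurableSingletonClass A]

theorem measurable_feature (M : LowRankMDP X A d H) (g : Fin H) :
    Measurable fun τ : Fin H → X × A => M.φ g (τ g).1 (τ g).2 :=
  (measurable_from_prod_countable_left (f := fun p : X × A => M.φ g p.1 p.2)
      (M.φ_measurable g)).comp (measurable_pi_apply g)

theorem measurable_meanFeature (M : LowRankMDP X A d H) (P : PolicyDist X A) (g : Fin H) :
    StronglyMeasurable fun i => meanFeature M (P.policy i) g := by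
  let R : Kernel P.Idx (Fin H → X × A) := ⟨_, measurable_trajLaw_section M P.kernel⟩
  exact StronglyMeasurable.integral_kernel (κ := R) (measurable_feature M g).stronglyMeasurable

theorem occupancy_nonneg (M : LowRankMDP X A d H) (π : Policy X A) {g h : Fin H}
    (hgh : (h : ℕ) = g + 1) (x : X) : 0 ≤ M.occupancy π h x := by
  rw [occupancy_eq_inner M π hgh, meanFeature, ← integral_inner]
  · refine integral_nonneg_of_ae ?_
    filter_upwards [LowRankMDP.ae_layer M π g g.2] with τ hτ
    exact M.density_nonneg g h hgh _ hτ _ _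
  · exact .of_bound (measurable_feature M g).aestronglyMeasurable 1 (ae_norm_feature_le M π g)

theorem integrable_meanFeature (M : LowRankMDP X A d H) (P : PolicyDist X A) (g : Fin H) :
    Integrable (fun i => meanFeature M (P.policy i) g) P.law :=
  .of_bound (measurable_meanFeature M P g).aestronglyMeasurable 1
    (.of_forall fun _ => norm_meanFeature_le M _ g)

theorem integral_occupancy (M : LowRankMDP X A d H) (P : PolicyDist X A) {g h : Fin H}
    (hgh : (h : ℕ) = g + 1) (x : X) :
    ∫ i, M.occupancy (P.policy i) h x ∂P.law =
      inner ℝ (M.μ h x) (∫ i, meanFeature M (P.policy i) g ∂P.law) := by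
  simp_rw [occupancy_eq_inner M _ hgh]
  exact integral_inner (integrable_meanFeature M P g) _

theorem stateAt_eq_withDensity (M : LowRankMDP X A d H) (π : Policy X A) {g h : Fin H}
    (hgh : (h : ℕ) = g + 1) :
    stateAt M π h = M.ν.withDensity fun x => ENNReal.ofReal (M.occupancy π h x) := by
  rw [← stateLaw_eq_stateAt, LowRankMDP.stateLaw_eq_withDensity M π h (by omega)]

/-- This is Tonelli over the index and the state. Joint measurability of the occupancy comes from
its form as the inner product of `μ` at the state with the mean feature of the index. -/
theorem mixState_eq_withDensity (M : LowRankMDP X A d H) (P : PolicyDist X A) {g h : Fin H}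
    (hgh : (h : ℕ) = g + 1) :
    mixState M P h =
      M.ν.withDensity fun x => ENNReal.ofReal (∫ i, M.occupancy (P.policy i) h x ∂P.law) := by
  have m1 : Measurable fun p : P.Idx × X => M.occupancy (P.policy p.1) h p.2 := by
    simp_rw [occupancy_eq_inner M _ hgh]
    exact ((M.μ_measurable h).comp measurable_snd).inner
      ((measurable_meanFeature M P g).measurable.comp measurable_fst)
  refine Measure.ext_of_lintegral _ fun f hf => ?_
  have m2 : Measurable fun x => ENNReal.ofReal (∫ i, M.occupancy (P.policy i) h x ∂P.law) := by
    simp_rw [integral_occupancy M P hgh]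
    exact ENNReal.measurable_ofReal.comp ((M.μ_measurable h).inner measurable_const)
  rw [lintegral_mixState M P h hf, lintegral_withDensity_eq_lintegral_mul _ m2 hf]
  have e : ∀ i, ∫⁻ x, f x ∂(stateAt M (P.policy i) h) =
      ∫⁻ x, ENNReal.ofReal (M.occupancy (P.policy i) h x) * f x ∂M.ν := fun i => by
    rw [stateAt_eq_withDensity M _ hgh, lintegral_withDensity_eq_lintegral_mul _
      (measurable_occupancy M _ hgh).ennreal_ofReal hf]
    rfl
  simp_rw [e]
  rw [lintegral_lintegral_swap]
  · refine lintegral_congr fun x => ?_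
    have m3 : Measurable fun i => M.occupancy (P.policy i) h x := by
      simp_rw [occupancy_eq_inner M _ hgh]
      exact measurable_const.inner (measurable_meanFeature M P g).measurable
    rw [lintegral_mul_const _ m3.ennreal_ofReal,
      Pi.mul_apply, ← ofReal_integral_eq_lintegral_ofReal]
    · simp_rw [occupancy_eq_inner M _ hgh]
      exact (integrable_meanFeature M P g).const_inner _
    · exact .of_forall fun i => occupancy_nonneg M _ hgh x
  · exact ((ENNReal.measurable_ofReal.comp m1).mul (hf.comp measurable_snd)).aemeasurable

/-- Off a set that every policy visits with small probability, the state law of any policy at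
layer `t` is dominated by that of a policy cover. -/
theorem exists_covered_set (M : LowRankMDP X A d H) (P : PolicyDist X A) {α ε : ℝ}
    (hα : α ∈ Set.Ioo 0 1) (hε : 0 < ε) (t : Fin H) (hP : IsRandomizedPolicyCover M P α ε t)
    (π : Policy X A) :
    ∃ G : Set X, MeasurableSet G ∧
      (∀ f : X → ENNReal, Measurable f →
        ∫⁻ x in G, f x ∂(stateAt M π t) ≤ ENNReal.ofReal (1 / α) * ∫⁻ x, f x ∂(mixState M P t)) ∧
      (stateAt M π t).real Gᶜ ≤ if (t : ℕ) = 0 then 0 else ε * (2 * (d * √(d : ℝ))) := by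
  have hα0 : 0 < α := hα.1
  by_cases ht : (t : ℕ) = 0
  · refine ⟨Set.univ, MeasurableSet.univ, fun f hf => ?_, by simp [ht]⟩
    have e : ∀ π' : Policy X A, stateAt M π' t = M.ρ := fun π' => by
      rw [← stateLaw_eq_stateAt, LowRankMDP.stateLaw_zero M π' t ht]
    rw [lintegral_mixState M P t hf]
    simp_rw [e]
    simp only [Measure.restrict_univ, lintegral_const, measure_univ, mul_one]
    refine le_mul_of_one_le_left zero_le ?_
    rw [ENNReal.one_le_ofReal, le_div_iff₀ hα0]
    linarith [hα.2]
  · let g : Fin H := ⟨t - 1, by omega⟩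
    have hg : (t : ℕ) = g + 1 := by simp only [g]; omega
    have mo := measurable_occupancy M π hg
    have mi : Measurable fun x => ∫ i, M.occupancy (P.policy i) t x ∂P.law := by
      simp_rw [integral_occupancy M P hg]
      exact (M.μ_measurable t).inner measurable_const
    -- The set compares `π` directly with the cover rather than through the supremum over all
    -- policies, which makes its measurability immediate.
    set G := {x | M.occupancy π t x ≤ 1 / α * ∫ i, M.occupancy (P.policy i) t x ∂P.law} with hG
    have mG : MeasurableSet G := measurableSet_le mo (mi.const_mul _)
    refine ⟨G, mG, fun f hf => ?_, ?_⟩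
    · rw [stateAt_eq_withDensity M π hg, mixState_eq_withDensity M P hg, restrict_withDensity mG,
        lintegral_withDensity_eq_lintegral_mul _ mo.ennreal_ofReal hf,
        lintegral_withDensity_eq_lintegral_mul _ mi.ennreal_ofReal hf,
        ← lintegral_const_mul _ (mi.ennreal_ofReal.mul hf)]
      refine (setLIntegral_mono ((mi.ennreal_ofReal.mul hf).const_mul _)
        fun x hx => ?_).trans (setLIntegral_le_lintegral G _)
      simp only [Pi.mul_apply, ← mul_assoc]
      gcongr
      rw [← ENNReal.ofReal_mul (by positivity)]
      exact ENNReal.ofReal_le_ofReal hx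
    · rw [if_neg ht]
      have hL := measurableSet_layer M t
      have e1 : stateAt M π t Gᶜ ≤ ENNReal.ofReal (ε * (2 * (d * √(d : ℝ)))) := by
        calc stateAt M π t Gᶜ ≤ stateAt M π t (Gᶜ ∩ {x | M.layer x = t}) := by
              refine measure_mono_ae ?_
              filter_upwards [stateAt_layer M π t] with x hx hxG
              exact ⟨hxG, hx⟩
          _ = ∫⁻ x in Gᶜ ∩ {x | M.layer x = t}, ENNReal.ofReal (M.occupancy π t x) ∂M.ν := by
              rw [stateAt_eq_withDensity M π hg, withDensity_apply _ (mG.compl.inter hL)]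
          _ ≤ ∫⁻ x in Gᶜ ∩ {x | M.layer x = t}, ENNReal.ofReal (ε * ‖M.μ t x‖) ∂M.ν := by
              refine setLIntegral_mono
                (ENNReal.measurable_ofReal.comp ((M.μ_measurable t).norm.const_mul _)) ?_
              rintro x ⟨hxG, hxt⟩
              refine ENNReal.ofReal_le_ofReal ?_
              -- If the occupancy of `π` exceeds `ε ‖μ‖`, so does the supremum, and the cover
              -- condition then puts `x` in `G`.
              by_contra hcon
              refine hxG ?_
              have h1 := occupancy_le_iSup M π hg x
              have h2 := hP x hxt ((not_le.1 hcon).le.trans h1)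
              change M.occupancy π t x ≤ 1 / α * _
              rw [one_div, ← div_eq_inv_mul, le_div_iff₀ hα0, mul_comm]
              exact (mul_le_mul_of_nonneg_left h1 hα0.le).trans h2
          _ ≤ ∫⁻ x in {x | M.layer x = t}, ENNReal.ofReal (ε * ‖M.μ t x‖) ∂M.ν :=
              lintegral_mono_set Set.inter_subset_right
          _ = ENNReal.ofReal (∫ x in {x | M.layer x = t}, ε * ‖M.μ t x‖ ∂M.ν) := by
              rw [ofReal_integral_eq_lintegral_ofReal]
              · exact (M.μ_integrable t).norm.const_mul _
              · exact .of_forall fun x => by positivity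
          _ ≤ _ := by
              refine ENNReal.ofReal_le_ofReal ?_
              rw [integral_const_mul]
              gcongr
              exact integral_norm_μ_le M t
      exact ENNReal.toReal_le_of_le_ofReal (by positivity) e1

end Structure

/-! ### Performance difference -/

section Performance

variable {X A : Type*} [MeasurableSpace X] [MeasurableSpace A] {d H : ℕ}

theorem integral_stateAt_succ (M : LowRankMDP X A d H) (π : Policy X A) (t : ℕ) {f : X → ℝ}
    (hf : Measurable f) {C : ℝ} (hC : ∀ x, |f x| ≤ C) :
    ∫ y, f y ∂(stateAt M π (t + 1)) =
      ∫ x, ∫ a, ∫ y, f y ∂(M.T (x, a)) ∂(π.1 x) ∂(stateAt M π t) := by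
  have hi : ∀ (m : Measure X) [IsProbabilityMeasure m], Integrable f m := fun m _ =>
    .of_bound hf.aestronglyMeasurable C (.of_forall hC)
  rw [stateAt_succ, integral_bind_kernel (hi _)]
  refine integral_congr_ae (.of_forall fun x => ?_)
  simp only [stepKernel]
  rw [Kernel.integral_comp (by exact hi (stepKernel M π x)), Kernel.prod_apply, Kernel.id_apply,
    Measure.dirac_prod, integral_map measurable_prodMk_left.aemeasurable
      (StronglyMeasurable.integral_kernel hf.stronglyMeasurable).aestronglyMeasurable]

theorem abs_integral_le {α : Type*} [MeasurableSpace α] (m : Measure α) [IsProbabilityMeasure m]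
    {f : α → ℝ} {C : ℝ} (hC : ∀ x, |f x| ≤ C) : |∫ x, f x ∂m| ≤ C := by
  simpa using norm_integral_le_of_norm_le_const (μ := m) (f := f) (C := C) (.of_forall hC)

/-- The Bellman equation, averaged over the states and actions of `π` at time `t`: the continuation
value is then averaged over the states of `π` at time `t + 1`. -/
theorem integral_qValue (M : LowRankMDP X A d H) {r : X × A → ℝ} (hr : Measurable r)
    (h1 : ∀ p, |r p| ≤ 1) (π π' : Policy X A) (k t : ℕ) :
    ∫ x, ∫ a, qValue M r π' k x a ∂(π.1 x) ∂(stateAt M π t) =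
      ∫ x, ∫ a, r (x, a) ∂(π.1 x) ∂(stateAt M π t) +
        ∫ y, rolloutValue M r π' k y ∂(stateAt M π (t + 1)) := by
  have mV := measurable_rolloutValue M hr π' k
  have bV := abs_rolloutValue_le M h1 π' k
  have mT : StronglyMeasurable fun p : X × A => ∫ y, rolloutValue M r π' k y ∂(M.T p) :=
    StronglyMeasurable.integral_kernel mV.stronglyMeasurable
  have bT : ∀ p : X × A, |∫ y, rolloutValue M r π' k y ∂(M.T p)| ≤ k := fun p =>
    abs_integral_le _ bV
  rw [integral_stateAt_succ M π t mV bV, ← integral_add]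
  · refine integral_congr_ae (.of_forall fun x => ?_)
    simp only [qValue]
    rw [integral_add]
    · exact .of_bound (hr.comp measurable_prodMk_left).aestronglyMeasurable 1
        (.of_forall fun a => h1 _)
    · exact .of_bound (mT.measurable.comp measurable_prodMk_left).aestronglyMeasurable k
        (.of_forall fun a => bT _)
  · exact .of_bound (StronglyMeasurable.integral_kernel_prod_right'
      hr.stronglyMeasurable).aestronglyMeasurable 1
      (.of_forall fun x => abs_integral_le _ fun a => h1 _)
  · exact .of_bound (StronglyMeasurable.integral_kernel_prod_right' mT).aestronglyMeasurable k
      (.of_forall fun x => abs_integral_le _ fun a => bT _)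

/-- The performance difference bound: if at every layer `t` the advantage of `π` over `π'` is at
most `b t` on average, then the value of `π` exceeds that of `π'` by at most `∑ b t`. -/
theorem performance_difference (M : LowRankMDP X A d H) {r : X × A → ℝ} (hr : Measurable r)
    (h1 : ∀ p, |r p| ≤ 1) (π π' : Policy X A) {b : ℕ → ℝ}
    (hb : ∀ t k, t + (k + 1) = H →
      ∫ x, ∫ a, qValue M r π' k x a ∂(π.1 x) ∂(stateAt M π t) ≤
        ∫ x, rolloutValue M r π' (k + 1) x ∂(stateAt M π t) + b t) (k : ℕ) :
    ∀ t, t + k = H →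
      ∫ x, rolloutValue M r π k x ∂(stateAt M π t) ≤
        ∫ x, rolloutValue M r π' k x ∂(stateAt M π t) + ∑ l ∈ Finset.Ico t H, b l := by
  induction k with
  | zero => intro t ht; obtain rfl : t = H := by omega
            simp [rolloutValue_zero]
  | succ k ih =>
    intro t ht
    have h2 := ih (t + 1) (by omega)
    have h3 := hb t k ht
    -- Continuing with `π` or with `π'` after a step of `π` yields the same immediate reward, which
    -- cancels; the difference of continuation values is handled by the induction hypothesis.
    have h4 := integral_qValue M hr h1 π π k t
    rw [integral_qValue M hr h1 π π' k t] at h3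
    rw [Finset.sum_eq_sum_Ico_succ_bot (by omega : t < H)]
    simp_rw [rolloutValue_succ M hr h1 π k]
    linarith

/-- Since `act` maximizes `g`, the advantage over it is at most two errors of `g`. Each is bounded
through the sum `f` of squared errors on the covered set; off that set the crude bound `2 (k + 1)`
is paid on a small mass. -/
theorem integral_advantage_le [Fintype A] [MeasurableSingletonClass A]
    (M : LowRankMDP X A d H) {r : X × A → ℝ} (hr : Measurable r) (h1 : ∀ p, |r p| ≤ 1)
    (P : PolicyDist X A) {α ε : ℝ} (hα : α ∈ Set.Ioo 0 1) (hε : 0 < ε) (t : Fin H)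
    (hP : IsRandomizedPolicyCover M P α ε t) (π π' : Policy X A) (k : ℕ)
    {g : X → A → ℝ} (hg : ∀ a, Measurable fun x => g x a) {C : ℝ} (hgC : ∀ x a, |g x a| ≤ C)
    {act : X → A} (hact : Measurable act) (hmax : ∀ x a, g x a ≤ g x (act x))
    {E : ℝ} (hE : 0 < E)
    (herr : ∫⁻ x, ∑ a, ENNReal.ofReal ((g x a - qValue M r π' k x a) ^ 2) ∂(mixState M P t) ≤
      ENNReal.ofReal E) :
    ∫ x, ∫ a, qValue M r π' k x a ∂(π.1 x) ∂(stateAt M π t) ≤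
      ∫ x, qValue M r π' k x (act x) ∂(stateAt M π t) +
        (2 * √(E / α) +
          2 * (k + 1) * if (t : ℕ) = 0 then 0 else ε * (2 * (d * √(d : ℝ)))) := by
  obtain ⟨G, mG, hG, hGc⟩ := exists_covered_set M P hα hε t hP π
  have hα0 := hα.1
  set Q := qValue M r π' k with hQ
  have mQ : Measurable fun p : X × A => Q p.1 p.2 := measurable_qValue M hr π' k
  have mQa : ∀ a, Measurable fun x => Q x a := fun a => mQ.comp measurable_prodMk_right
  have bQ : ∀ x a, |Q x a| ≤ k + 1 := abs_qValue_le M h1 π' k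
  set f : X → ℝ := fun x => ∑ a, (g x a - Q x a) ^ 2 with hf
  have mf : Measurable f := Finset.measurable_sum _ fun a _ => ((hg a).sub (mQa a)).pow_const 2
  have f0 : ∀ x, 0 ≤ f x := fun x => Finset.sum_nonneg fun a _ => sq_nonneg _
  have bf : ∀ x, |f x| ≤ Fintype.card A * (C + (k + 1)) ^ 2 := by
    intro x
    rw [abs_of_nonneg (f0 x)]
    refine (Finset.sum_le_card_nsmul _ _ ((C + (k + 1)) ^ 2) fun a _ => ?_).trans (by simp)
    rw [← sq_abs]
    gcongr
    exact (abs_sub _ _).trans (add_le_add (hgC x a) (bQ x a))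
  set c := √(E / α) with hc
  have c0 : 0 < c := Real.sqrt_pos.2 (by positivity)
  have c2 : c * c = E / α := Real.mul_self_sqrt (by positivity)
  -- The inequality `2 c |e| ≤ e² + c²` replaces Cauchy–Schwarz. The choice `c = √(E / α)` balances
  -- the two halves, because `f` integrates to at most `E / α` over the covered set.
  have hterm : ∀ x a, |g x a - Q x a| ≤ (f x / c + c) / 2 := by
    intro x a
    have h2 : (g x a - Q x a) ^ 2 ≤ f x :=
      Finset.single_le_sum (f := fun a => (g x a - Q x a) ^ 2) (fun a _ => sq_nonneg _)
        (Finset.mem_univ a)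
    have h3 : 0 ≤ (|g x a - Q x a| - c) ^ 2 := sq_nonneg _
    have h4 : |g x a - Q x a| * (2 * c) ≤ f x + c * c := by
      rw [sub_sq, sq_abs] at h3
      nlinarith
    have h5 : (f x / c + c) / 2 = (f x + c * c) / (2 * c) := by field_simp
    rw [h5, le_div_iff₀ (by positivity)]
    exact h4
  have adv1 : ∀ x a, Q x a ≤ Q x (act x) + (f x / c + c) := by
    intro x a
    have := abs_le.1 (hterm x a)
    have := abs_le.1 (hterm x (act x))
    have := hmax x a
    linarith
  have adv2 : ∀ x a, Q x a ≤ Q x (act x) + 2 * (k + 1) := by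
    intro x a
    have := abs_le.1 (bQ x a)
    have := abs_le.1 (bQ x (act x))
    linarith
  set s := stateAt M π t with hs
  have iQ : Integrable (fun x => Q x (act x)) s :=
    .of_bound (mQ.comp (measurable_id.prodMk hact)).aestronglyMeasurable (k + 1)
      (.of_forall fun x => bQ _ _)
  have iF : Integrable (fun x => f x / c + c) s :=
    (Integrable.div_const (.of_bound mf.aestronglyMeasurable _ (.of_forall bf)) c).add
      (integrable_const _)
  have iU : Integrable (fun x => G.indicator (fun x => f x / c + c) x +
      Gᶜ.indicator (fun _ => 2 * ((k : ℝ) + 1)) x) s :=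
    (iF.indicator mG).add ((integrable_const _).indicator mG.compl)
  have hle : ∀ x, ∫ a, Q x a ∂(π.1 x) ≤ Q x (act x) +
      (G.indicator (fun x => f x / c + c) x + Gᶜ.indicator (fun _ => 2 * ((k : ℝ) + 1)) x) := by
    intro x
    have iQx : Integrable (fun a => Q x a) (π.1 x) :=
      .of_bound (mQ.comp measurable_prodMk_left).aestronglyMeasurable (k + 1)
        (.of_forall fun a => bQ _ _)
    refine (integral_mono iQx (integrable_const (Q x (act x) +
      (G.indicator (fun x => f x / c + c) x + Gᶜ.indicator (fun _ => 2 * ((k : ℝ) + 1)) x)))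
      fun a => ?_).trans (by simp)
    by_cases hx : x ∈ G
    · simpa [hx] using adv1 x a
    · simpa [hx] using adv2 x a
  have hGf : ∫ x in G, f x ∂s ≤ E / α := by
    have hi : Integrable f (s.restrict G) :=
      (Integrable.of_bound mf.aestronglyMeasurable _ (.of_forall bf))
    have h2 := hG (fun x => ENNReal.ofReal (f x)) mf.ennreal_ofReal
    rw [← ofReal_integral_eq_lintegral_ofReal hi (.of_forall f0)] at h2
    have h3 : ∫⁻ x, ENNReal.ofReal (f x) ∂(mixState M P t) ≤ ENNReal.ofReal E := by
      refine le_trans (le_of_eq (lintegral_congr fun x => ?_)) herr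
      exact ENNReal.ofReal_sum_of_nonneg fun a _ => sq_nonneg _
    have h4 := h2.trans (mul_le_mul_right h3 _)
    rw [← ENNReal.ofReal_mul (by positivity), ENNReal.ofReal_le_ofReal_iff (by positivity)] at h4
    calc _ ≤ _ := h4
      _ = _ := by ring
  calc ∫ x, ∫ a, Q x a ∂(π.1 x) ∂s
      ≤ ∫ x, (Q x (act x) + (G.indicator (fun x => f x / c + c) x +
          Gᶜ.indicator (fun _ => 2 * ((k : ℝ) + 1)) x)) ∂s := by
        refine integral_mono ?_ (iQ.add iU) hle
        exact .of_bound (StronglyMeasurable.integral_kernel_prod_right'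
          mQ.stronglyMeasurable).aestronglyMeasurable (k + 1)
          (.of_forall fun x => abs_integral_le _ fun a => bQ x a)
    _ = ∫ x, Q x (act x) ∂s + (∫ x in G, (f x / c + c) ∂s + s.real Gᶜ * (2 * (k + 1))) := by
        rw [integral_add iQ iU, integral_add (iF.indicator mG)
          ((integrable_const _).indicator mG.compl), integral_indicator mG,
          integral_indicator mG.compl, setIntegral_const, smul_eq_mul]
    _ ≤ _ := by
        have h6 : ∫ x in G, (f x / c + c) ∂s ≤ 2 * c := by
          rw [integral_add, integral_div, setIntegral_const, smul_eq_mul]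
          · have h7 : (∫ x in G, f x ∂s) / c ≤ c := by
              rw [div_le_iff₀ c0, c2]; exact hGf
            have h8 : s.real G * c ≤ 1 * c := by gcongr; exact measureReal_le_one
            linarith
          · exact Integrable.div_const (.of_bound mf.aestronglyMeasurable _ (.of_forall bf)) c
          · exact integrable_const _
        have h9 : s.real Gᶜ * (2 * (k + 1)) ≤
            (if (t : ℕ) = 0 then 0 else ε * (2 * (d * √(d : ℝ)))) * (2 * (k + 1)) := by
          gcongr
        linarith

end Performance

/-! ### The regression step -/

section Regression

variable {X A : Type*} [MeasurableSpace X] [MeasurableSpace A] {d H n : ℕ}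

theorem measurable_linearReward (M : LowRankMDP X A d H) (θ : Fin H → EuclideanSpace ℝ (Fin d))
    (h : Fin H) (a : A) : Measurable fun x => linearReward M θ h x a :=
  measurable_const.inner (M.φ_measurable h a)

theorem abs_layerReward_linearReward_le (M : LowRankMDP X A d H)
    {θ : Fin H → EuclideanSpace ℝ (Fin d)} (hθ : ∀ h, ‖θ h‖ ≤ 1) (p : X × A) :
    |layerReward M (linearReward M θ) p| ≤ 1 :=
  abs_inner_le_of_norm_le (hθ _) (M.φ_norm _ _ _ rfl)

variable [Fintype A]

/-- The squared distance of `g` to the action values of `π'` at layer `t`, summed over the actions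
and averaged over the states that `P` visits. -/
noncomputable def fitError (M : LowRankMDP X A d H) (r : X × A → ℝ) (P : PolicyDist X A)
    (t : Fin H) (g : X → A → ℝ) (π' : Policy X A) : ENNReal :=
  ∫⁻ x, ∑ a, ENNReal.ofReal ((g x a - qValue M r π' (H - t - 1) x a) ^ 2) ∂(mixState M P t)

theorem fitError_congr (M : LowRankMDP X A d H) (r : X × A → ℝ) (P : PolicyDist X A)
    (t : Fin H) (g : X → A → ℝ) {π π' : Policy X A}
    (h : ∀ x, (t : ℕ) + 1 ≤ (M.layer x : ℕ) → π.1 x = π'.1 x) :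
    fitError M r P t g π = fitError M r P t g π' := by
  refine lintegral_congr_ae ?_
  filter_upwards [mixState_layer M P t] with x hx
  refine Finset.sum_congr rfl fun a _ => ?_
  rw [qValue_congr M r h (H - t - 1) x (by rw [hx]) (by omega) a]

variable [MeasurableSingletonClass A] [Nonempty A]

/-- A uniform action weighs each action by one over their number, so a sum over all actions costs
that number as a factor. The sum is what allows the bound to be used at the unknown actions of `π`
and of the greedy rule. -/
theorem lintegral_sampleLaw_stateAction (M : LowRankMDP X A d H) {r : Fin H → X → A → ℝ}
    (hr : ∀ h a, Measurable fun x => r h x a) (P : PolicyDist X A) (t : Fin H) (π' : Policy X A)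
    {f : X × A → ENNReal} (hf : Measurable f) :
    ∫⁻ x, ∑ a, f (x, a) ∂(mixState M P t) =
      Fintype.card A * ∫⁻ z, f (z.1, z.2.1) ∂(sampleLaw M r P t π') := by
  obtain ⟨k, hk⟩ : ∃ k, (t : ℕ) + (k + 1) = H := ⟨H - t - 1, by omega⟩
  have hc : (Fintype.card A : ENNReal) ≠ 0 := by simp
  rw [lintegral_sampleLaw M hr P t k hk π' (f := fun z => f (z.1, z.2.1)) (hf.comp (by fun_prop))]
  simp only [lintegral_const, measure_univ, mul_one]
  have e : ∀ x, ∫⁻ a, f (x, a) ∂(uniformOn Set.univ) =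
      (∑ a, f (x, a)) * (Fintype.card A : ENNReal)⁻¹ := by
    intro x
    rw [lintegral_fintype, Finset.sum_mul]
    refine Finset.sum_congr rfl fun a _ => ?_
    rw [uniformOn_univ, Measure.count_singleton, one_div]
  simp_rw [e]
  have ms : Measurable fun x => ∑ a, f (x, a) :=
    Finset.measurable_sum _ fun a _ => hf.comp measurable_prodMk_right
  rw [lintegral_mul_const _ ms,
    mul_comm (Fintype.card A : ENNReal), mul_assoc, ENNReal.inv_mul_cancel hc (by simp), mul_one]

theorem sampleLaw_ae_layer (M : LowRankMDP X A d H) {r : Fin H → X → A → ℝ}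
    (hr : ∀ h a, Measurable fun x => r h x a) (P : PolicyDist X A) (t : Fin H) (π' : Policy X A) :
    ∀ᵐ z ∂(sampleLaw M r P t π'), M.layer z.1 = t := by
  obtain ⟨k, hk⟩ : ∃ k, (t : ℕ) + (k + 1) = H := ⟨H - t - 1, by omega⟩
  have hL := measurableSet_layer M t
  have hm : MeasurableSet {z : X × A × ℝ | M.layer z.1 = t} := measurable_fst hL
  rw [sampleLaw_eq_compProd M hr P t k hk π', ae_map_iff (by fun_prop) hm]
  refine Measure.ae_compProd_of_ae_fst (p := fun p : X × A => M.layer p.1 = t) _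
    (measurable_fst hL) ?_
  exact Measure.quasiMeasurePreserving_fst.ae (mixState_layer M P t)

theorem sampleLaw_ae_abs_le (M : LowRankMDP X A d H) {r : Fin H → X → A → ℝ}
    (hr : ∀ h a, Measurable fun x => r h x a) (h1 : ∀ p, |layerReward M r p| ≤ 1)
    (P : PolicyDist X A) (t : Fin H) (π' : Policy X A) :
    ∀ᵐ z ∂(sampleLaw M r P t π'), |z.2.2| ≤ (H : ℝ) := by
  obtain ⟨k, hk⟩ : ∃ k, (t : ℕ) + (k + 1) = H := ⟨H - t - 1, by omega⟩
  have hr' := measurable_layerReward M hr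
  have hkH : (k : ℝ) + 1 ≤ H := by exact_mod_cast (by omega : k + 1 ≤ H)
  have := isMarkovKernel_returnKernel M hr' π' k
  have hm : MeasurableSet {z : X × A × ℝ | |z.2.2| ≤ (H : ℝ)} :=
    measurableSet_le (by fun_prop) measurable_const
  rw [sampleLaw_eq_compProd M hr P t k hk π', ae_map_iff (by fun_prop) hm]
  refine Measure.ae_compProd_of_ae_ae (measurableSet_le (by fun_prop) measurable_const) ?_
  refine .of_forall fun p => ?_
  filter_upwards [abs_returnKernel_le M hr' h1 π' k p] with s hs
  exact hs.trans hkH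

/-- In a sample, the return minus the action value is orthogonal to the functions of the state and
the action. -/
theorem integral_sampleLaw_mul_residual (M : LowRankMDP X A d H) {r : Fin H → X → A → ℝ}
    (hr : ∀ h a, Measurable fun x => r h x a) (h1 : ∀ p, |layerReward M r p| ≤ 1)
    (P : PolicyDist X A) (t : Fin H) (k : ℕ) (hk : (t : ℕ) + (k + 1) = H) (π' : Policy X A)
    {f : X × A → ℝ} (hf : Measurable f) {C : ℝ} (hC : ∀ p, |f p| ≤ C) :
    ∫ z, f (z.1, z.2.1) * (z.2.2 - qValue M (layerReward M r) π' k z.1 z.2.1)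
      ∂(sampleLaw M r P t π') = 0 := by
  have hr' := measurable_layerReward M hr
  have := isMarkovKernel_returnKernel M hr' π' k
  have mQ := measurable_qValue M hr' π' k
  have bQ := abs_qValue_le M h1 π' k
  have mF : Measurable fun z : X × A × ℝ =>
      f (z.1, z.2.1) * (z.2.2 - qValue M (layerReward M r) π' k z.1 z.2.1) :=
    (hf.comp (by fun_prop)).mul ((by fun_prop : Measurable fun z : X × A × ℝ => z.2.2).sub
      (mQ.comp (by fun_prop : Measurable fun z : X × A × ℝ => (z.1, z.2.1))))
  have iR : ∀ p, Integrable (fun s : ℝ => s) (returnKernel M (layerReward M r) π' k p) := fun p =>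
    .of_bound measurable_id.aestronglyMeasurable _ (abs_returnKernel_le M hr' h1 π' k p)
  have mG : Measurable fun q : (X × A) × ℝ =>
      f q.1 * (q.2 - qValue M (layerReward M r) π' k q.1.1 q.1.2) :=
    (hf.comp measurable_fst).mul (measurable_snd.sub (mQ.comp measurable_fst))
  rw [sampleLaw_eq_compProd M hr P t k hk π', integral_map (by fun_prop) mF.aestronglyMeasurable]
  change ∫ q : (X × A) × ℝ, f q.1 * (q.2 - qValue M (layerReward M r) π' k q.1.1 q.1.2) ∂_ = 0
  rw [Measure.integral_compProd]
  · refine integral_eq_zero_of_ae (.of_forall fun p => ?_)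
    simp only [Pi.zero_apply]
    rw [integral_const_mul, integral_sub (iR p) (integrable_const _),
      integral_returnKernel M hr' h1 π' k p]
    simp
  · refine .of_bound mG.aestronglyMeasurable (C * ((k + 1) + (k + 1))) ?_
    refine Measure.ae_compProd_of_ae_ae (measurableSet_le mG.norm measurable_const) ?_
    refine .of_forall fun p => ?_
    filter_upwards [abs_returnKernel_le M hr' h1 π' k p] with s hs
    rw [Real.norm_eq_abs, abs_mul]
    have hC0 : 0 ≤ C := (abs_nonneg _).trans (hC p)
    refine mul_le_mul (hC p) ?_ (abs_nonneg _) hC0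
    exact (abs_sub _ _).trans (add_le_add hs (bQ _ _))

/-- In each round of PSDP, the fitted function is close to the action values with high
probability. -/
theorem measure_fitError_lt_le (M : LowRankMDP X A d H) (hd : 1 ≤ d) (hn : 1 ≤ n)
    {Φ : Finset (X → A → EuclideanSpace ℝ (Fin d))} {θ : Fin H → EuclideanSpace ℝ (Fin d)}
    (hφΦ : ∀ h, M.φ h ∈ Φ) (hΦ1 : ∀ φ ∈ Φ, ∀ x a, ‖φ x a‖ ≤ 1)
    (hΦm : ∀ φ ∈ Φ, ∀ a, Measurable fun x => φ x a) (hθ : ∀ h, ‖θ h‖ ≤ 1)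
    {B : ℝ} (hB2 : 2 * (H : ℝ) * √(d : ℝ) = B)
    (S : Selection (fun _ : Fin H => linearClass Φ B) n)
    (P : PolicyDist X A) (t : Fin H) (π' : Policy X A) (s : ℝ) :
    (Measure.pi fun _ : Fin n => sampleLaw M (linearReward M θ) P t π')
      {D | ENNReal.ofReal (Fintype.card A * ((22 + 200 * s) * B ^ 2 / n)) <
        fitError M (layerReward M (linearReward M θ)) P t (S.fit t D) π'} ≤
      ENNReal.ofReal (Φ.card * (2 * ⌈(n : ℝ) * √(d : ℝ)⌉₊ + 1 : ℝ) ^ d * Real.exp (-s)) := by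
  have hk : (t : ℕ) + ((H - t - 1) + 1) = H := by omega
  have hm := measurable_linearReward (X := X) (A := A) M θ
  have hr' := measurable_layerReward M hm
  have h1 := abs_layerReward_linearReward_le M hθ
  have hsd : 1 ≤ √(d : ℝ) := Real.one_le_sqrt.2 (by exact_mod_cast hd)
  have hH : (1 : ℝ) ≤ H := by exact_mod_cast (by omega : 1 ≤ H)
  have hB : (H : ℝ) ≤ B := by rw [← hB2]; nlinarith
  have hB0 : 0 < B := by linarith
  set r := layerReward M (linearReward M θ) with hr
  set m := sampleLaw M (linearReward M θ) P t π' with hmdef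
  have : IsProbabilityMeasure m := sampleLaw_prob M hm P t π'
  set q : X × A × ℝ → ℝ := fun z => qValue M r π' (H - t - 1) z.1 z.2.1 with hq
  have mQ := measurable_qValue M hr' π' (H - t - 1)
  have mq : Measurable q := mQ.comp (by fun_prop : Measurable fun z : X × A × ℝ => (z.1, z.2.1))
  have hQH : ∀ x a, |qValue M r π' (H - t - 1) x a| ≤ H := fun x a => by
    refine (abs_qValue_le M h1 π' _ x a).trans ?_
    exact_mod_cast (by omega : H - t - 1 + 1 ≤ H)
  have mφ : ∀ φ ∈ Φ, Measurable fun p : X × A => φ p.1 p.2 := fun φ hφ =>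
    measurable_from_prod_countable_left (hΦm φ hφ)
  obtain ⟨w₀, hw₀, hqw⟩ := exists_qValue_eq_inner M hd hθ hr' h1 π' t _ hk
  have key := least_squares_bound m hd hn Φ (ψ := fun φ z => φ z.1 z.2.1)
    (fun φ hφ => (mφ φ hφ).comp (by fun_prop : Measurable fun z : X × A × ℝ => (z.1, z.2.1)))
    (fun φ hφ z => hΦ1 φ hφ _ _) mq (R := fun z => z.2.2) (by fun_prop) hB0
    (.of_forall fun z => (hQH _ _).trans hB)
    ((sampleLaw_ae_abs_le M hm h1 P t π').mono fun z hz => hz.trans hB)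
    (fun φ hφ w => integral_sampleLaw_mul_residual M hm h1 P t _ hk π'
      (f := fun p => inner ℝ (φ p.1 p.2) w - qValue M r π' (H - t - 1) p.1 p.2)
      (((mφ φ hφ).inner measurable_const).sub mQ) (C := ‖w‖ + H) fun p =>
        (abs_sub _ _).trans (add_le_add (abs_inner_le_of_norm_le (hΦ1 φ hφ _ _) le_rfl)
          (hQH _ _))) s
  refine (measure_mono_ae ?_).trans key
  have hae : ∀ᵐ D ∂(Measure.pi fun _ : Fin n => m), ∀ j, M.layer (D j).1 = t :=
    ae_all_iff.2 fun j => (Measure.quasiMeasurePreserving_eval (fun _ : Fin n => m) j).ae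
      (sampleLaw_ae_layer M hm P t π')
  filter_upwards [hae] with D hD hlt
  obtain ⟨φ, hφ, w, hw, hfit⟩ := S.fit_mem t D
  refine ⟨φ, hφ, w, hw, ?_, ?_⟩
  -- Realizability: at the sampled states, all in layer `t`, the action value agrees with the member
  -- of the class given by `φ⋆` and `w₀`. So the fit has at most the empirical loss of the
  -- regression function.
  · have h2 := S.fit_min t D _ ⟨M.φ t, hφΦ t, w₀, hw₀.trans_eq hB2, rfl⟩
    rw [hfit] at h2
    refine h2.trans (le_of_eq (Finset.sum_congr rfl fun j _ => ?_))
    simp only [hq]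
    rw [hqw _ (hD j)]
  · by_contra hcon
    refine absurd hlt (not_lt.2 ?_)
    have mh : Measurable fun p : X × A =>
        (inner ℝ (φ p.1 p.2) w - qValue M r π' (H - t - 1) p.1 p.2) ^ 2 :=
      (((mφ φ hφ).inner measurable_const).sub mQ).pow_const 2
    rw [fitError, hfit, lintegral_sampleLaw_stateAction M hm P t π' (f := fun p =>
      ENNReal.ofReal ((inner ℝ (φ p.1 p.2) w - qValue M r π' (H - t - 1) p.1 p.2) ^ 2))
      mh.ennreal_ofReal, ENNReal.ofReal_mul (by positivity), ENNReal.ofReal_natCast]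
    gcongr
    rw [← ofReal_integral_eq_lintegral_ofReal]
    · exact ENNReal.ofReal_le_ofReal (not_lt.1 hcon)
    · refine .of_bound (mh.comp
        (by fun_prop : Measurable fun z : X × A × ℝ => (z.1, z.2.1))).aestronglyMeasurable
        ((‖w‖ + H) ^ 2) (.of_forall fun z => ?_)
      simp only [Real.norm_eq_abs]
      rw [abs_pow]
      gcongr
      exact (abs_sub _ _).trans (add_le_add (abs_inner_le_of_norm_le (hΦ1 φ hφ _ _) le_rfl)
        (hQH _ _))
    · exact .of_forall fun z => sq_nonneg _

end Regression

/-! ### The law of the datasets -/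

section Union

variable {X A : Type*} [MeasurableSpace X] [MeasurableSpace A] {d H n : ℕ}

theorem measurable_cons_dataset (k : ℕ) :
    Measurable fun p : Dataset X A n × (Fin k → Dataset X A n) =>
      Fin.cons (α := fun _ => Dataset X A n) p.1 p.2 := by
  refine measurable_pi_iff.2 fun i => ?_
  refine Fin.cases ?_ (fun j => ?_) i
  · simpa using measurable_fst
  · simp only [Fin.cons_succ]
    exact (measurable_pi_apply j).comp measurable_snd

theorem measurable_rolloutValue_section (M : LowRankMDP X A d H) {r : X × A → ℝ}
    (hr : Measurable r) {Z : Type*} [MeasurableSpace Z] (κ : Kernel (Z × X) A) [IsMarkovKernel κ]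
    (k : ℕ) : Measurable fun p : Z × X => rolloutValue M r (sectionPolicy κ p.1) k p.2 := by
  let R : Kernel (Z × X) (Fin k → X × A) := ⟨_, measurable_rollout_section M κ k⟩
  exact (StronglyMeasurable.integral_kernel (κ := R)
    (measurable_sum_rewards hr k).stronglyMeasurable).measurable

theorem measurable_qValue_section (M : LowRankMDP X A d H) {r : X × A → ℝ}
    (hr : Measurable r) {Z : Type*} [MeasurableSpace Z] (κ : Kernel (Z × X) A) [IsMarkovKernel κ]
    (k : ℕ) (a : A) : Measurable fun p : Z × X => qValue M r (sectionPolicy κ p.1) k p.2 a := by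
  have m1 : Measurable fun p : Z × X => (p.2, a) := by fun_prop
  refine (hr.comp m1).add ?_
  change Measurable fun p : Z × X =>
    ∫ y, rolloutValue M r (sectionPolicy κ p.1) k y ∂(M.T.comap _ m1 p)
  refine (StronglyMeasurable.integral_kernel_prod_right'
    (f := fun q : (Z × X) × X => rolloutValue M r (sectionPolicy κ q.1.1) k q.2) ?_).measurable
  exact ((measurable_rolloutValue_section M hr κ k).comp
    (by fun_prop : Measurable fun q : (Z × X) × X => (q.1.1, q.2))).stronglyMeasurable

variable [Nonempty A] {G : Fin H → Set (X → A → ℝ)}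

theorem measurable_learnedAct (M : LowRankMDP X A d H) (S : Selection G n) (k : ℕ) :
    Measurable fun p : (Fin k → Dataset X A n) × X => learnedAct S p.1 (M.layer p.2) p.2 := by
  have h : Measurable fun q : Fin H × ((Fin k → Dataset X A n) × X) =>
      learnedAct S q.2.1 q.1 q.2.2 := by
    refine measurable_from_prod_countable_right fun j => ?_
    simp only [learnedAct]
    split_ifs with hj
    · have m : Measurable fun y : (Fin k → Dataset X A n) × X =>
          (y.1 ⟨(j : ℕ) - (H - k), by omega⟩, y.2) := by fun_prop
      exact (S.act_measurable j).comp m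
    · exact measurable_const
  exact h.comp ((M.layer_measurable.comp measurable_snd).prodMk measurable_id)

/-- The learned policy, as a kernel of the datasets and the state. -/
noncomputable def learnedKernel (M : LowRankMDP X A d H) (S : Selection G n) (k : ℕ) :
    Kernel ((Fin k → Dataset X A n) × X) A :=
  Kernel.deterministic _ (measurable_learnedAct M S k)

instance (M : LowRankMDP X A d H) (S : Selection G n) (k : ℕ) :
    IsMarkovKernel (learnedKernel M S k) := by
  unfold learnedKernel; infer_instance

theorem learnedPolicy_eq_section (M : LowRankMDP X A d H) (S : Selection G n) {k : ℕ}
    (D : Fin k → Dataset X A n) : learnedPolicy M S D = sectionPolicy (learnedKernel M S k) D :=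
  Subtype.ext (Kernel.ext fun x => by
    simp [learnedPolicy, sectionPolicy, learnedKernel, Kernel.deterministic_apply])

theorem learnedPolicy_apply (M : LowRankMDP X A d H) (S : Selection G n) {k : ℕ}
    (D : Fin k → Dataset X A n) (x : X) :
    (learnedPolicy M S D).1 x = Measure.dirac (learnedAct S D (M.layer x) x) := by
  simp only [learnedPolicy, Kernel.deterministic_apply]

/-- The new dataset is put in front and all indices shift by one, so each layer from `H - k` on
still reads its own dataset. -/
theorem learnedPolicy_cons (M : LowRankMDP X A d H) (S : Selection G n) {k : ℕ} (hk : k + 1 ≤ H)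
    (D : Fin k → Dataset X A n) (D' : Dataset X A n) (x : X) (hx : H - k ≤ (M.layer x : ℕ)) :
    (learnedPolicy M S (Fin.cons (α := fun _ => Dataset X A n) D' D)).1 x =
      (learnedPolicy M S D).1 x := by
  rw [learnedPolicy_apply, learnedPolicy_apply, learnedAct, learnedAct, dif_pos hx,
    dif_pos (by omega)]
  have : (⟨(M.layer x : ℕ) - (H - (k + 1)), by omega⟩ : Fin (k + 1)) =
      Fin.succ ⟨(M.layer x : ℕ) - (H - k), by omega⟩ := by ext; simp; omega
  rw [this, Fin.cons_succ]

variable [Fintype A]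

theorem measurable_fitError (M : LowRankMDP X A d H) {r : X × A → ℝ} (hr : Measurable r)
    (S : Selection G n) (P : PolicyDist X A) (t : Fin H) (k : ℕ) :
    Measurable fun p : Dataset X A n × (Fin k → Dataset X A n) =>
      fitError M r P t (S.fit t p.1) (learnedPolicy M S p.2) := by
  simp_rw [fitError, learnedPolicy_eq_section]
  refine Measurable.lintegral_prod_right' (f := fun q :
    (Dataset X A n × (Fin k → Dataset X A n)) × X => ∑ a, ENNReal.ofReal ((S.fit t q.1.1 q.2 a -
      qValue M r (sectionPolicy (learnedKernel M S k) q.1.2) (H - t - 1) q.2 a) ^ 2)) ?_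
  refine Finset.measurable_sum _ fun a _ => Measurable.ennreal_ofReal (Measurable.pow_const ?_ 2)
  exact ((S.fit_measurable t a).comp ((measurable_fst.comp measurable_fst).prodMk
    measurable_snd)).sub ((measurable_qValue_section M hr (learnedKernel M S k) _ a).comp
      ((measurable_snd.comp measurable_fst).prodMk measurable_snd))

/-- The datasets of the last `k` layers for which the fitted function has an error above `β` at
some layer. -/
def badData (M : LowRankMDP X A d H) (r : X × A → ℝ) (S : Selection G n)
    (P : Fin H → PolicyDist X A) (β : ENNReal) (k : ℕ) : Set (Fin k → Dataset X A n) :=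
  {D | ∃ t : Fin H, ∃ h : H - k ≤ (t : ℕ),
    β < fitError M r (P t) t (S.fit t (D ⟨t - (H - k), by omega⟩)) (learnedPolicy M S D)}

theorem measurableSet_badData (M : LowRankMDP X A d H) {r : X × A → ℝ} (hr : Measurable r)
    (S : Selection G n) (P : Fin H → PolicyDist X A) (β : ENNReal) (k : ℕ) :
    MeasurableSet (badData M r S P β k) := by
  have e : badData M r S P β k = ⋃ (t : Fin H) (h : H - k ≤ (t : ℕ)), {D | β <
      fitError M r (P t) t (S.fit t (D ⟨t - (H - k), by omega⟩)) (learnedPolicy M S D)} := by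
    ext D
    simp only [Set.mem_iUnion]
    rfl
  rw [e]
  refine MeasurableSet.iUnion fun t => MeasurableSet.iUnion fun h => ?_
  have m : Measurable fun D : Fin k → Dataset X A n =>
      (D ⟨(t : ℕ) - (H - k), by omega⟩, D) := (measurable_pi_apply _).prodMk measurable_id
  have m2 := (measurable_fitError M hr S (P t) t k).comp m
  simp only [Function.comp_def] at m2
  exact measurableSet_lt measurable_const m2

variable [MeasurableSingletonClass A]

theorem measurable_pi_sampleLaw (M : LowRankMDP X A d H) {r : Fin H → X → A → ℝ}
    (hr : ∀ h a, Measurable fun x => r h x a) (S : Selection G n) (P : PolicyDist X A) (t : Fin H)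
    (k : ℕ) : Measurable fun D : Fin k → Dataset X A n =>
      Measure.pi fun _ : Fin n => sampleLaw M r P t (learnedPolicy M S D) := by
  have := fun D : Fin k → Dataset X A n => sampleLaw_prob M hr P t (learnedPolicy M S D)
  refine measurable_pi_const n ?_
  simp_rw [learnedPolicy_eq_section]
  exact measurable_sampleLaw_section M hr P t _

/-- `Measure.bind` can be evaluated as an iterated integral once the conditional law is measurable
in the past data; this measurability is most of the proof. -/
theorem psdpLaw_succ_apply (M : LowRankMDP X A d H) {r : Fin H → X → A → ℝ}
    (hr : ∀ h a, Measurable fun x => r h x a) (S : Selection G n) (P : Fin H → PolicyDist X A)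
    (k : ℕ) (hk : k + 1 ≤ H) {s : Set (Fin (k + 1) → Dataset X A n)} (hs : MeasurableSet s) :
    psdpLaw M r S P (k + 1) hk s =
      ∫⁻ D, (Measure.pi fun _ : Fin n => sampleLaw M r (P ⟨H - (k + 1), by omega⟩)
          ⟨H - (k + 1), by omega⟩ (learnedPolicy M S D))
        {D' | Fin.cons (α := fun _ => Dataset X A n) D' D ∈ s}
        ∂(psdpLaw M r S P k (by omega)) := by
  set t : Fin H := ⟨H - (k + 1), by omega⟩ with ht
  let κ : Kernel (Fin k → Dataset X A n) (Dataset X A n) :=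
    ⟨_, measurable_pi_sampleLaw M hr S (P t) t k⟩
  have hκ : IsMarkovKernel κ := ⟨fun D => by
    have := sampleLaw_prob M hr (P t) t (learnedPolicy M S D)
    change IsProbabilityMeasure (Measure.pi fun _ : Fin n => sampleLaw M r (P t) t
      (learnedPolicy M S D))
    infer_instance⟩
  have mc : ∀ D : Fin k → Dataset X A n, Measurable fun D' : Dataset X A n =>
      Fin.cons (α := fun _ => Dataset X A n) D' D := fun D =>
    (measurable_cons_dataset k).comp measurable_prodMk_right
  have happ : ∀ (D : Fin k → Dataset X A n) {s : Set (Fin (k + 1) → Dataset X A n)},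
      MeasurableSet s → ((κ D).map fun D' => Fin.cons (α := fun _ => Dataset X A n) D' D) s =
        κ D {D' | Fin.cons (α := fun _ => Dataset X A n) D' D ∈ s} := fun D s hs =>
    Measure.map_apply (mc D) hs
  have mb : Measurable fun D : Fin k → Dataset X A n =>
      (κ D).map fun D' => Fin.cons (α := fun _ => Dataset X A n) D' D := by
    refine Measure.measurable_of_measurable_coe _ fun s hs => ?_
    simp_rw [happ _ hs]
    exact Kernel.measurable_kernel_prodMk_left (κ := κ)
      (t := {p | Fin.cons (α := fun _ => Dataset X A n) p.2 p.1 ∈ s})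
      (((measurable_cons_dataset k).comp measurable_swap) hs)
  rw [psdpLaw]
  change ((psdpLaw M r S P k _).bind fun D => (κ D).map fun D' =>
    Fin.cons (α := fun _ => Dataset X A n) D' D) s = _
  rw [Measure.bind_apply hs mb.aemeasurable]
  simp_rw [happ _ hs]
  rfl

theorem psdpLaw_prob (M : LowRankMDP X A d H) {r : Fin H → X → A → ℝ}
    (hr : ∀ h a, Measurable fun x => r h x a) (S : Selection G n) (P : Fin H → PolicyDist X A)
    (k : ℕ) (hk : k ≤ H) : IsProbabilityMeasure (psdpLaw M r S P k hk) := by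
  induction k with
  | zero => rw [psdpLaw]; infer_instance
  | succ k ih =>
    have := ih (by omega)
    have := fun t (D : Fin k → Dataset X A n) =>
      sampleLaw_prob M hr (P t) t (learnedPolicy M S D)
    constructor
    rw [psdpLaw_succ_apply M hr S P k hk MeasurableSet.univ]
    simp

/-- Given the past data, the continuation policy is fixed, so the uniform bound `η` applies to the
new round. The errors of earlier rounds are functions of the past data alone, so a union bound over
rounds works despite adaptivity. -/
theorem psdpLaw_badData_le (M : LowRankMDP X A d H) {r : Fin H → X → A → ℝ}
    (hr : ∀ h a, Measurable fun x => r h x a) (S : Selection G n) (P : Fin H → PolicyDist X A)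
    {β η : ENNReal}
    (hη : ∀ (t : Fin H) (π' : Policy X A),
      (Measure.pi fun _ : Fin n => sampleLaw M r (P t) t π')
        {D | β < fitError M (layerReward M r) (P t) t (S.fit t D) π'} ≤ η) (k : ℕ) (hk : k ≤ H) :
    psdpLaw M r S P k hk (badData M (layerReward M r) S P β k) ≤ k * η := by
  have hr' := measurable_layerReward M hr
  induction k with
  | zero =>
    have : badData M (layerReward M r) S P β 0 = ∅ := by
      ext D
      simp only [badData, Set.mem_ofPred_eq, Set.mem_empty_iff_false, iff_false]
      rintro ⟨t, h, -⟩
      omega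
    simp [this]
  | succ k ih =>
    have := psdpLaw_prob M hr S P k (by omega)
    have hprob := fun t (D : Fin k → Dataset X A n) =>
      sampleLaw_prob M hr (P t) t (learnedPolicy M S D)
    have mB := measurableSet_badData M hr' S P β k
    rw [psdpLaw_succ_apply M hr S P k hk (measurableSet_badData M hr' S P β (k + 1))]
    set t₀ : Fin H := ⟨H - (k + 1), by omega⟩ with ht₀
    have hpt : ∀ D : Fin k → Dataset X A n,
        (Measure.pi fun _ : Fin n => sampleLaw M r (P t₀) t₀ (learnedPolicy M S D))
          {D' | Fin.cons (α := fun _ => Dataset X A n) D' D ∈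
            badData M (layerReward M r) S P β (k + 1)} ≤
        (badData M (layerReward M r) S P β k).indicator 1 D + η := by
      intro D
      by_cases hD : D ∈ badData M (layerReward M r) S P β k
      · rw [Set.indicator_of_mem hD]
        exact prob_le_one.trans le_self_add
      · rw [Set.indicator_of_notMem hD, zero_add]
        refine (measure_mono ?_).trans (hη t₀ (learnedPolicy M S D))
        rintro D' ⟨t, h, hlt⟩
        -- The error at layer `t` sees the learned policy only after `t`, where the new dataset is
        -- not consulted.
        rw [fitError_congr M (layerReward M r) (P t) t _ (fun x hx =>
          learnedPolicy_cons M S hk D D' x (by omega))] at hlt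
        rcases Nat.lt_or_ge (t : ℕ) (H - k) with hlt' | hge
        · obtain rfl : t = t₀ := Fin.ext (by simp only [ht₀]; omega)
          have : (⟨(t₀ : ℕ) - (H - (k + 1)), by omega⟩ : Fin (k + 1)) = 0 := by ext; simp [ht₀]
          rw [this, Fin.cons_zero] at hlt
          exact hlt
        · refine absurd ⟨t, hge, ?_⟩ hD
          have : (⟨(t : ℕ) - (H - (k + 1)), by omega⟩ : Fin (k + 1)) =
              Fin.succ ⟨(t : ℕ) - (H - k), by omega⟩ := by ext; simp; omega
          rw [this, Fin.cons_succ] at hlt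
          exact hlt
    refine (lintegral_mono hpt).trans ?_
    rw [lintegral_add_right _ measurable_const, lintegral_indicator_one mB, lintegral_const,
      measure_univ, mul_one]
    push_cast
    rw [add_mul, one_mul]
    gcongr
    exact ih (by omega)

end Union

/-! ### Constants -/

section Constants

theorem sum_remaining_steps (m : ℕ) :
    ∑ t ∈ Finset.range m, 2 * ((m : ℝ) - t) = m * (m + 1) := by
  induction m with
  | zero => simp
  | succ m ih =>
    rw [Finset.sum_range_succ']
    have : ∀ t : ℕ, ((m + 1 : ℕ) : ℝ) - ((t + 1 : ℕ) : ℝ) = m - t := fun t => by push_cast; ring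
    simp_rw [this]
    rw [ih]
    push_cast
    ring

/-- The absence of uncovered mass on the first layer matters for the constant: without the term `t =
0` the weights sum to `H (H - 1)`, with it to `H (H + 1)`, which exceeds `H²`. -/
theorem sum_layer_bounds_le (H : ℕ) {a b : ℝ} (hb : 0 ≤ b) :
    ∑ t ∈ Finset.Ico 0 H, (a + 2 * ((H : ℝ) - t) * if t = 0 then 0 else b) ≤
      H * a + H ^ 2 * b := by
  rw [Nat.Ico_zero_eq_range, Finset.sum_add_distrib]
  simp only [Finset.sum_const, Finset.card_range, nsmul_eq_mul]
  gcongr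
  cases H with
  | zero => simp
  | succ m =>
    rw [Finset.sum_range_succ']
    have : ∀ t : ℕ, ((m + 1 : ℕ) : ℝ) - ((t + 1 : ℕ) : ℝ) = m - t := fun t => by push_cast; ring
    simp only [this, Nat.add_eq_zero_iff, one_ne_zero, and_false, if_false, if_true, mul_zero,
      add_zero]
    rw [← Finset.sum_mul, sum_remaining_steps]
    gcongr
    push_cast
    nlinarith [(Nat.cast_nonneg m : (0 : ℝ) ≤ m)]

/-- With `x = 2 n √d H`, the number of grid values per coordinate is at most `x³` and `H ≤ x`, so
the logarithm is at most `3 d log x + log x` plus the logarithm of `N / δ`. The lower bound on `Γ`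
later absorbs additive constants. -/
theorem log_union_le {d H n N : ℕ} (hd : 1 ≤ d) (hH : 1 ≤ H) (hn : 1 ≤ n) (hN : 1 ≤ N) {δ : ℝ}
    (hδ : δ ∈ Set.Ioo 0 1) :
    let Γ := (d : ℝ) * Real.log (2 * (n : ℝ) * √(d : ℝ) * (H : ℝ)) + Real.log ((n : ℝ) * N / δ)
    1 / 2 ≤ Γ ∧ Real.log (N * (2 * ⌈(n : ℝ) * √(d : ℝ)⌉₊ + 1 : ℝ) ^ d * H / δ) ≤ 4 * Γ := by
  intro Γ
  have hd1 : (1 : ℝ) ≤ d := by exact_mod_cast hd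
  have hH1 : (1 : ℝ) ≤ H := by exact_mod_cast hH
  have hn1 : (1 : ℝ) ≤ n := by exact_mod_cast hn
  have hN1 : (1 : ℝ) ≤ N := by exact_mod_cast hN
  have hs1 : 1 ≤ √(d : ℝ) := Real.one_le_sqrt.2 hd1
  have hδ0 := hδ.1
  have hns : 1 ≤ (n : ℝ) * √(d : ℝ) := one_le_mul_of_one_le_of_one_le hn1 hs1
  set y := (n : ℝ) * √(d : ℝ) with hy
  set x := 2 * (n : ℝ) * √(d : ℝ) * (H : ℝ) with hx
  have hxy : x = 2 * y * H := by rw [hx, hy]; ring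
  have hx2 : 2 * y ≤ x := by rw [hxy]; nlinarith
  have hxH : (H : ℝ) ≤ x := by rw [hxy]; nlinarith
  have hx0 : 0 < x := by linarith
  set L := Real.log x with hL
  have hL2 : Real.log 2 ≤ L := Real.log_le_log two_pos (by linarith)
  have hL1 : 1 / 2 ≤ L := by
    have := Real.log_two_gt_d9
    linarith
  have hdL : L ≤ d * L := by nlinarith
  have hC : (2 * ⌈y⌉₊ + 1 : ℝ) ≤ x ^ 3 := by
    have h1 := (Nat.ceil_lt_add_one (by linarith : 0 ≤ y)).le
    have h2 : x * 4 ≤ x ^ 3 := by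
      have : 4 ≤ x ^ 2 := by nlinarith
      calc x * 4 ≤ x * x ^ 2 := by gcongr
        _ = x ^ 3 := by ring
    linarith
  have hlogC : Real.log (2 * ⌈y⌉₊ + 1 : ℝ) ≤ 3 * L := by
    refine (Real.log_le_log (by positivity) hC).trans (le_of_eq ?_)
    rw [Real.log_pow, hL]
    norm_num
  have hNδ : 1 ≤ (N : ℝ) / δ := by
    rw [le_div_iff₀ hδ0]
    linarith [hδ.2]
  have hlogN : 0 ≤ Real.log (N / δ) := Real.log_nonneg hNδ
  have hlogn : Real.log (N / δ) ≤ Real.log ((n : ℝ) * N / δ) := by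
    refine Real.log_le_log (by linarith) ?_
    gcongr
    nlinarith
  have hlogH : Real.log H ≤ L := Real.log_le_log (by linarith) hxH
  refine ⟨?_, ?_⟩
  · change 1 / 2 ≤ d * L + _
    linarith
  · have e : (N : ℝ) * (2 * ⌈y⌉₊ + 1 : ℝ) ^ d * H / δ = (2 * ⌈y⌉₊ + 1 : ℝ) ^ d * (H * (N / δ)) := by
      ring
    rw [e, Real.log_mul (by positivity) (by positivity), Real.log_mul (by positivity)
      (by positivity), Real.log_pow]
    have : (d : ℝ) * Real.log (2 * ⌈y⌉₊ + 1 : ℝ) ≤ d * (3 * L) := by gcongr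
    change _ ≤ 4 * (d * L + _)
    linarith

/-- Since `s ≤ 4 Γ` and `1 ≤ 2 Γ`, one gets `4 (22 + 200 s) ≤ 3376 Γ ≤ 3600 Γ = 60² Γ`; doubling 60
yields the absolute constant 120. -/
theorem statistical_term_le {d A H n α s Γ : ℝ} (hd : 0 ≤ d) (hA : 0 ≤ A) (hH : 0 ≤ H) (hn : 0 < n)
    (hα : 0 < α) (hΓ : 1 / 2 ≤ Γ) (hs : s ≤ 4 * Γ) :
    H * (2 * √(A * ((22 + 200 * s) * (2 * H * √d) ^ 2 / n) / α)) ≤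
      120 * H ^ 2 * √(d * A * Γ / (α * n)) := by
  have h1 : A * ((22 + 200 * s) * (2 * H * √d) ^ 2 / n) / α ≤
      (60 * H) ^ 2 * (d * A * Γ / (α * n)) := by
    rw [mul_pow, mul_pow, Real.sq_sqrt hd]
    have e1 : A * ((22 + 200 * s) * (2 ^ 2 * H ^ 2 * d) / n) / α =
        (4 * (22 + 200 * s)) * (A * H ^ 2 * d / (n * α)) := by field_simp; ring
    have e2 : (60 * H) ^ 2 * (d * A * Γ / (α * n)) =
        (3600 * Γ) * (A * H ^ 2 * d / (n * α)) := by field_simp; ring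
    rw [e1, e2]
    exact mul_le_mul_of_nonneg_right (by linarith) (by positivity)
  have h2 : √(A * ((22 + 200 * s) * (2 * H * √d) ^ 2 / n) / α) ≤
      60 * H * √(d * A * Γ / (α * n)) := by
    refine (Real.sqrt_le_sqrt h1).trans (le_of_eq ?_)
    rw [Real.sqrt_mul (by positivity), Real.sqrt_sq (by positivity)]
  calc _ ≤ H * (2 * (60 * H * √(d * A * Γ / (α * n)))) := by gcongr
    _ = _ := by ring

end Constants

/-! ### The guarantee -/

section Guarantee

variable {X A : Type*} [MeasurableSpace X] [MeasurableSpace A] [MeasurableSingletonClass A]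
  [Fintype A] [Nonempty A] {d H n : ℕ}

/-- If all the fitted functions are close to the action values, then the learned policy is
nearly optimal. -/
theorem value_le_of_notMem_badData (M : LowRankMDP X A d H)
    {Φ : Finset (X → A → EuclideanSpace ℝ (Fin d))} {θ : Fin H → EuclideanSpace ℝ (Fin d)}
    (hΦ1 : ∀ φ ∈ Φ, ∀ x a, ‖φ x a‖ ≤ 1) (hθ : ∀ h, ‖θ h‖ ≤ 1) {B : ℝ}
    (S : Selection (fun _ : Fin H => linearClass Φ B) n)
    (P : Fin H → PolicyDist X A) {α ε : ℝ} (hα : α ∈ Set.Ioo 0 1) (hε : 0 < ε)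
    (hP : ∀ h, IsRandomizedPolicyCover M (P h) α ε h) {E : ℝ} (hE : 0 < E)
    {D : Fin H → Dataset X A n}
    (hD : D ∉ badData M (layerReward M (linearReward M θ)) S P (ENNReal.ofReal E) H)
    (π : Policy X A) :
    M.value (linearReward M θ) π ≤ M.value (linearReward M θ) (learnedPolicy M S D) +
      (H * (2 * √(E / α)) + H ^ 2 * (ε * (2 * (d * √(d : ℝ))))) := by
  have hm := measurable_linearReward (X := X) (A := A) M θ
  have hr' := measurable_layerReward M hm
  have h1 := abs_layerReward_linearReward_le M hθ
  have key := performance_difference M hr' h1 π (learnedPolicy M S D)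
    (b := fun t => 2 * √(E / α) +
      2 * ((H : ℝ) - t) * if t = 0 then 0 else ε * (2 * (d * √(d : ℝ)))) ?_ H 0 (by omega)
  -- At time 0 the state law is `ρ` for every policy, so both values can be written as integrals
  -- against `stateAt M π 0`.
  · have e : ∀ π' : Policy X A, M.value (linearReward M θ) π' =
        ∫ x, rolloutValue M (layerReward M (linearReward M θ)) π' H x ∂(stateAt M π 0) :=
      value_eq_integral_rolloutValue M hm h1
    rw [e, e]
    refine key.trans ?_
    gcongr
    exact sum_layer_bounds_le H (by positivity)
  · intro t k hk
    let t' : Fin H := ⟨t, by omega⟩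
    have hkH : (H : ℝ) - t = k + 1 := by
      rw [← hk]; push_cast; ring
    have hkt : H - t - 1 = k := by omega
    have herr : fitError M (layerReward M (linearReward M θ)) (P t') t' (S.fit t' (D t'))
        (learnedPolicy M S D) ≤ ENNReal.ofReal E := by
      by_contra hcon
      refine hD ⟨t', by simp, ?_⟩
      have : (⟨(t' : ℕ) - (H - H), by omega⟩ : Fin H) = t' := by ext; simp
      rw [this]
      exact not_le.1 hcon
    simp only [fitError, t', hkt] at herr
    obtain ⟨φ, hφ, w, hw, hfit⟩ := S.fit_mem t' (D t')
    have adv := integral_advantage_le M hr' h1 (P t') hα hε t' (hP t') π (learnedPolicy M S D) k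
      (g := S.fit t' (D t'))
      (fun a => (S.fit_measurable t' a).comp measurable_prodMk_left) (C := B)
      (fun x a => by rw [hfit]; exact abs_inner_le_of_norm_le (hΦ1 φ hφ x a) hw)
      (act := S.act t' (D t')) ((S.act_measurable t').comp measurable_prodMk_left)
      (S.act_max t' (D t')) hE herr
    refine adv.trans (le_of_eq ?_)
    simp only [hkH, t']
    congr 1
    refine integral_congr_ae ?_
    filter_upwards [stateAt_layer M π t'] with x hx
    rw [rolloutValue_succ M hr' h1, learnedPolicy_apply]
    have hact : learnedAct S D (M.layer x) x = S.act t' (D t') x := by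
      rw [hx, learnedAct, dif_pos (by simp)]
      congr 2
      ext
      simp
    rw [hact, integral_dirac]

end Guarantee

end LowRank

/-! ### The main theorem: choice of the confidence level and assembly. -/

theorem mainTheorem12 :
    ∃ c : ℝ, 0 < c ∧
      ∀ (X A : Type*) [MeasurableSpace X] [MeasurableSpace A] [MeasurableSingletonClass A]
        [Fintype A] [Nonempty A] (d H n : ℕ) (M : LowRank.LowRankMDP X A d H)
        (Φ : Finset (X → A → EuclideanSpace ℝ (Fin d)))
        (θ : Fin H → EuclideanSpace ℝ (Fin d))
        (P : Fin H → LowRank.PolicyDist X A) (α ε δ : ℝ),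
        1 ≤ n → α ∈ Set.Ioo 0 1 → ε ∈ Set.Ioo 0 1 → δ ∈ Set.Ioo 0 1 →
        (∀ h, M.φ h ∈ Φ) →
        (∀ φ ∈ Φ, ∀ x a, ‖φ x a‖ ≤ 1) →
        (∀ φ ∈ Φ, ∀ a, Measurable fun x => φ x a) →
        (∀ h, ‖θ h‖ ≤ 1) →
        (∀ h, LowRank.IsRandomizedPolicyCover M (P h) α ε h) →
        ∀ S : LowRank.Selection
            (fun _ : Fin H => LowRank.linearClass Φ (2 * (H : ℝ) * √(d : ℝ))) n,
          ENNReal.ofReal (1 - δ) ≤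
            LowRank.psdpLaw M (LowRank.linearReward M θ) S P H le_rfl
              {D | ∀ π : LowRank.Policy X A,
                M.value (LowRank.linearReward M θ) π ≤
                  M.value (LowRank.linearReward M θ) (LowRank.learnedPolicy M S D) +
                    c * (H : ℝ) ^ 2 *
                      √((d : ℝ) * (Fintype.card A : ℝ) *
                          ((d : ℝ) * Real.log (2 * (n : ℝ) * √(d : ℝ) * (H : ℝ)) +
                            Real.log ((n : ℝ) * (Φ.card : ℝ) / δ)) / (α * (n : ℝ))) +
                    2 * (H : ℝ) ^ 2 * ε * (d : ℝ) ^ (3 / 2 : ℝ)} := by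
  refine ⟨120, by norm_num, ?_⟩
  intro X A _ _ _ _ _ d H n M Φ θ P α ε δ hn hα hε hδ hφΦ hΦ1 hΦm hθ hP S
  have hm := LowRank.measurable_linearReward (X := X) (A := A) M θ
  have hprob := LowRank.psdpLaw_prob M hm S P H le_rfl
  have hα0 := hα.1
  have hδ0 := hδ.1
  have hε0 := hε.1
  -- In dimension 0 all rewards and values vanish; the regression bounds need `1 ≤ d`.
  rcases Nat.eq_zero_or_pos d with rfl | hd
  · have hv : ∀ π : LowRank.Policy X A, M.value (LowRank.linearReward M θ) π = 0 := fun π => by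
      have : ∀ h x a, LowRank.linearReward M θ h x a = 0 := fun h x a => by
        simp [LowRank.linearReward, Subsingleton.elim (θ h) 0]
      simp [LowRank.LowRankMDP.value, this]
    have : {D : Fin H → LowRank.Dataset X A n | ∀ π : LowRank.Policy X A,
        M.value (LowRank.linearReward M θ) π ≤
          M.value (LowRank.linearReward M θ) (LowRank.learnedPolicy M S D) +
            120 * (H : ℝ) ^ 2 * √(((0 : ℕ) : ℝ) * (Fintype.card A : ℝ) *
              (((0 : ℕ) : ℝ) * Real.log (2 * (n : ℝ) * √((0 : ℕ) : ℝ) * (H : ℝ)) +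
                Real.log ((n : ℝ) * (Φ.card : ℝ) / δ)) / (α * (n : ℝ))) +
            2 * (H : ℝ) ^ 2 * ε * ((0 : ℕ) : ℝ) ^ (3 / 2 : ℝ)} = Set.univ := by
      refine Set.eq_univ_of_forall fun D π => ?_
      rw [hv, hv]
      positivity
    rw [this, measure_univ]
    exact ENNReal.ofReal_le_one.2 (by linarith)
  -- The initial law is a probability measure, so there is a state; its layer shows `1 ≤ H`, and the
  -- feature map of that layer shows that `Φ` is nonempty.
  obtain ⟨x₀⟩ : Nonempty X := by
    by_contra hX
    rw [not_nonempty_iff] at hX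
    have := M.ρ_prob.measure_univ
    simp [Set.univ_eq_empty_iff.2 hX] at this
  have hH : 1 ≤ H := (M.layer x₀).pos
  have hcard : 1 ≤ Φ.card := Finset.card_pos.2 ⟨_, hφΦ (M.layer x₀)⟩
  obtain ⟨hΓ, hs⟩ := LowRank.log_union_le hd hH hn hcard hδ
  set Γ := (d : ℝ) * Real.log (2 * (n : ℝ) * √(d : ℝ) * (H : ℝ)) +
    Real.log ((n : ℝ) * (Φ.card : ℝ) / δ) with hΓdef
  set W := (Φ.card : ℝ) * (2 * ⌈(n : ℝ) * √(d : ℝ)⌉₊ + 1 : ℝ) ^ d with hW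
  have hcard1 : (1 : ℝ) ≤ Φ.card := by exact_mod_cast hcard
  have hH1 : (1 : ℝ) ≤ H := by exact_mod_cast hH
  have hn0 : (0 : ℝ) < n := by exact_mod_cast hn
  have hd0 : (0 : ℝ) < d := by exact_mod_cast hd
  have hW1 : 1 ≤ W := one_le_mul_of_one_le_of_one_le hcard1
    (one_le_pow₀ (by linarith [(Nat.cast_nonneg ⌈(n : ℝ) * √(d : ℝ)⌉₊ : (0 : ℝ) ≤ _)]))
  -- This makes the failure probability `W * exp (-s)` of a round equal to `δ / H`, hence `δ` over
  -- the `H` rounds.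
  set s := Real.log (W * H / δ) with hsdef
  have hs0 : 0 ≤ s := by
    refine Real.log_nonneg ?_
    rw [le_div_iff₀ hδ0]
    nlinarith [hδ.2]
  have hWs : W * Real.exp (-s) = δ / H := by
    rw [hsdef, Real.exp_neg, Real.exp_log (by positivity)]
    field_simp
  set E := (Fintype.card A : ℝ) * ((22 + 200 * s) * (2 * (H : ℝ) * √(d : ℝ)) ^ 2 / n) with hE
  have hA0 : (0 : ℝ) < Fintype.card A := by exact_mod_cast Fintype.card_pos
  have hE0 : 0 < E := by positivity
  have hbad := LowRank.psdpLaw_badData_le M hm S P (β := ENNReal.ofReal E)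
    (η := ENNReal.ofReal (δ / H)) (fun t π' => by
      rw [← hWs]
      exact LowRank.measure_fitError_lt_le M hd hn hφΦ hΦ1 hΦm hθ rfl S (P t) t π' s) H le_rfl
  have hδH : (H : ENNReal) * ENNReal.ofReal (δ / H) = ENNReal.ofReal δ := by
    rw [← ENNReal.ofReal_natCast, ← ENNReal.ofReal_mul (by positivity)]
    congr 1
    field_simp
  rw [hδH] at hbad
  have hmB := LowRank.measurableSet_badData M (LowRank.measurable_layerReward M hm) S P
    (ENNReal.ofReal E) H
  have hcompl := prob_compl_eq_one_sub hmB
    (μ := LowRank.psdpLaw M (LowRank.linearReward M θ) S P H le_rfl)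
  calc ENNReal.ofReal (1 - δ) = 1 - ENNReal.ofReal δ := by
        rw [ENNReal.ofReal_sub _ hδ0.le, ENNReal.ofReal_one]
    _ ≤ LowRank.psdpLaw M (LowRank.linearReward M θ) S P H le_rfl
        (LowRank.badData M (LowRank.layerReward M (LowRank.linearReward M θ)) S P
          (ENNReal.ofReal E) H)ᶜ := by
        rw [hcompl]
        exact tsub_le_tsub_left hbad 1
    _ ≤ _ := by
        refine measure_mono fun D hD π => ?_
        refine (LowRank.value_le_of_notMem_badData M hΦ1 hθ S P hα hε0 hP hE0 hD π).trans ?_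
        rw [add_assoc]
        have h1 := LowRank.statistical_term_le hd0.le hA0.le (by linarith : (0 : ℝ) ≤ H) hn0 hα0
          hΓ hs
        have h2 : (H : ℝ) ^ 2 * (ε * (2 * (d * √(d : ℝ)))) =
            2 * (H : ℝ) ^ 2 * ε * (d : ℝ) ^ (3 / 2 : ℝ) := by
          have : (d : ℝ) ^ (3 / 2 : ℝ) = d * √(d : ℝ) := by
            rw [Real.sqrt_eq_rpow, ← Real.rpow_one_add' hd0.le (by norm_num)]
            norm_num
          rw [this]
          ring
        rw [h2]
        gcongr
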